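/- \textbf{Setting.} On $L^2(0,\infty)$ let $K_{\max}f=-f''$ with domain $\{f\in L^2(0,\infty): f,f'\in AC_{\rm loc}(0,\infty),\ f''\in L^2(0,\infty)\}$ and let $K_{\min}$ be its restriction to those $f$ with $f(0^+)=f'(0^+)=0$. All roots are principal branches. Let $\mathbb C_+$ be the open upper half-plane. For $w\in\mathbb C$ let $\mathcal D_w=\operatorname{ran}(K_{\min}-\overline w)^{\perp}=\ker(K_{\min}^*-w)$. Put $$\psi(w;x)=e^{i\sqrt w\,x}\ (w\in\mathbb C_+),\qquad \phi^+(x)=2^{1/4}e^{i\sqrt{i}\,x},\qquad \phi^-(x)=2^{1/4}e^{-i\sqrt{-i}\,x}.$$ For $|\alpha|=1$ let $K_{1,\alpha}$ be the restriction of $K_{\max}$ to $\operatorname{dom}K_{\min}+\operatorname{span}\{\alpha\phi^--\phi^+\}$. The Liv\v sic characteristic function is $$B(w)=\frac{w-i}{w+i}\,\frac{\langle\psi(w),\phi^-\rangle}{\langle\psi(w),\phi^+\rangle},\qquad w\in\mathbb C_+,\qquad \langle f,g\rangle=\int_0^\infty f\,\overline g\,dx.$$ Let $\gamma(w)=\frac{w-i}{w+i}$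 and $B=b\circ\gamma$. The Clark measure $\mu^{b\alpha^*}$ on the unit circle $\mathbb T$ is the finite positive measure with $\int_{\mathbb T}\frac{1-|z|^2}{|t-z|^2}\,d\mu^{b\alpha^*}(t)=\operatorname{Re}\frac{\alpha+b(z)}{\alpha-b(z)}$ for $|z|<1$; the Clark measure $\mu^{B\alpha^*}$ of $K_{1,\alpha}$ on $\mathbb R$ is its pullback, $\mu^{B\alpha^*}(\Omega)=\mu^{b\alpha^*}(\gamma(\Omega))$. Let $m$ be Lebesgue measure on $\mathbb R$. \textbf{Theorem.} (1) For every $w\in\mathbb C_+$ the space $\mathcal D_w$ is spanned by $\psi(w)\neq0$; $\mathcal D_{i}$ and $\mathcal D_{-i}$ are spanned by the unit vectors $\phi^+$ and $\phi^-$ respectively. (2) $B$ is analytic and contractive on $\mathbb C_+$, and $$B(w)=\frac{(w-i)\bigl(\sqrt w-(1-i)/\sqrt2\bigr)}{(w+i)\bigl(\sqrt w+(1+i)/\sqrt2\bigr)},\qquad w\in\mathbb C_+.$$ (3) For every $\alpha\in\mathbb C$ with $|\alpha|=1$, $K_{1,\alpha}$ is a self-adjoint extension of $K_{\min}$, its Clark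 measure $\mu^{B\alpha^*}$ exists and is unique, and the density of the absolutely continuous part of $\mu^{B\alpha^*}$ is, for $m$-a.e. $s\in\mathbb R$, $$\frac{d\mu^{B\alpha^*}}{dm}(s)=\frac{2\operatorname{Re}\sqrt{2s}}{\pi\bigl(|s|+1+2\operatorname{Re}(\sqrt s\,e^{-i\pi/4})\bigr)\,\mathscr D(s)},$$ $$\mathscr D(s)=2(1-\operatorname{Re}\alpha)s^2+2|s|+|i\alpha-1|^2-2^{3/2}(1-\operatorname{Re}\alpha)s^{3/2}+2(1-\operatorname{Re}\alpha+\operatorname{Im}\alpha)s-2^{3/2}(1+\operatorname{Im}\alpha)s^{1/2}.$$ In particular the density vanishes for a.e. $s\le0$. -/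

import Mathlib

open MeasureTheory Filter Topology Set

noncomputable section

namespace HalfLine

/-- The Hilbert space `L²(0, ∞)` of complex-valued functions. -/
abbrev L2 : Type := Lp ℂ 2 (volume.restrict (Ioi (0 : ℝ)))

/-- Local absolute continuity on `(0, ∞)`. -/
def ACLoc (f : ℝ → ℂ) : Prop :=
  ∀ a b : ℝ, 0 < a → a ≤ b → AbsolutelyContinuousOnInterval f a b

/-- `f` is a representative of `u` such that `f` and its derivative `f' = g` are locally absolutely
continuous on `(0, ∞)`, and `v = -f''` almost everywhere (in particular `-f''` is in `L²`). -/
structure IsRep (f g : ℝ → ℂ) (u v : L2) : Prop where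
  ae_eq : ∀ᵐ x ∂(volume.restrict (Ioi (0 : ℝ))), u x = f x
  ac : ACLoc f
  hasDeriv : ∀ x : ℝ, 0 < x → HasDerivAt f (g x) x
  ac_deriv : ACLoc g
  ae_hasDeriv : ∀ᵐ x ∂(volume.restrict (Ioi (0 : ℝ))), HasDerivAt g (-(v x)) x

theorem ACLoc.zero : ACLoc (0 : ℝ → ℂ) := fun _ _ _ _ =>
  (contDiffOn_const (c := (0 : ℂ)) (n := 1)).absolutelyContinuousOnInterval

theorem ACLoc.add {f g : ℝ → ℂ} (hf : ACLoc f) (hg : ACLoc g) : ACLoc (f + g) :=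
  fun a b ha hab => AbsolutelyContinuousOnInterval.add (hf a b ha hab) (hg a b ha hab)

theorem ACLoc.smul {f : ℝ → ℂ} (c : ℂ) (hf : ACLoc f) : ACLoc (c • f) :=
  fun a b ha hab => AbsolutelyContinuousOnInterval.const_smul c (hf a b ha hab)

theorem IsRep.zero : IsRep 0 0 0 0 where
  ae_eq := by filter_upwards [Lp.coeFn_zero ℂ 2 (volume.restrict (Ioi (0 : ℝ)))] with x hx using hx
  ac := ACLoc.zero
  hasDeriv := fun x _ => hasDerivAt_const x 0
  ac_deriv := ACLoc.zero
  ae_hasDeriv := by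
    filter_upwards [Lp.coeFn_zero ℂ 2 (volume.restrict (Ioi (0 : ℝ)))] with x hx
    rw [hx, Pi.zero_apply, neg_zero]
    exact hasDerivAt_const x (0 : ℂ)

theorem IsRep.add {f g f' g' : ℝ → ℂ} {u v u' v' : L2} (h : IsRep f g u v)
    (h' : IsRep f' g' u' v') : IsRep (f + f') (g + g') (u + u') (v + v') where
  ae_eq := by
    filter_upwards [Lp.coeFn_add u u', h.ae_eq, h'.ae_eq] with x h1 h2 h3
    rw [h1, Pi.add_apply, Pi.add_apply, h2, h3]
  ac := h.ac.add h'.ac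
  hasDeriv := fun x hx => (h.hasDeriv x hx).add (h'.hasDeriv x hx)
  ac_deriv := h.ac_deriv.add h'.ac_deriv
  ae_hasDeriv := by
    filter_upwards [Lp.coeFn_add v v', h.ae_hasDeriv, h'.ae_hasDeriv] with x h1 h2 h3
    rw [h1, Pi.add_apply, neg_add]
    exact h2.add h3

theorem IsRep.smul {f g : ℝ → ℂ} {u v : L2} (c : ℂ) (h : IsRep f g u v) :
    IsRep (c • f) (c • g) (c • u) (c • v) where
  ae_eq := by
    filter_upwards [Lp.coeFn_smul c u, h.ae_eq] with x h1 h2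
    rw [h1, Pi.smul_apply, Pi.smul_apply, h2]
  ac := h.ac.smul c
  hasDeriv := fun x hx => (h.hasDeriv x hx).const_smul c
  ac_deriv := h.ac_deriv.smul c
  ae_hasDeriv := by
    filter_upwards [Lp.coeFn_smul c v, h.ae_hasDeriv] with x h1 h2
    rw [h1, Pi.smul_apply, ← smul_neg]
    exact h2.const_smul c

/-- The graph of the maximal operator `-d²/dx²` on `L²(0, ∞)`. -/
def maxGraph : Submodule ℂ (L2 × L2) where
  carrier := {p | ∃ f g : ℝ → ℂ, IsRep f g p.1 p.2}
  zero_mem' := ⟨0, 0, IsRep.zero⟩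
  add_mem' := by
    rintro p q ⟨f, g, h⟩ ⟨f', g', h'⟩
    exact ⟨f + f', g + g', h.add h'⟩
  smul_mem' := by
    rintro c p ⟨f, g, h⟩
    exact ⟨c • f, c • g, h.smul c⟩

/-- The graph of the minimal operator: additionally `f(0+) = f'(0+) = 0`. -/
def minGraph : Submodule ℂ (L2 × L2) where
  carrier := {p | ∃ f g : ℝ → ℂ, IsRep f g p.1 p.2 ∧
    Tendsto f (𝓝[>] 0) (𝓝 0) ∧ Tendsto g (𝓝[>] 0) (𝓝 0)}
  zero_mem' := ⟨0, 0, IsRep.zero, tendsto_const_nhds, tendsto_const_nhds⟩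
  add_mem' := by
    rintro p q ⟨f, g, h, hf, hg⟩ ⟨f', g', h', hf', hg'⟩
    exact ⟨f + f', g + g', h.add h', by rw [← add_zero (0 : ℂ)]; exact hf.add hf',
      by rw [← add_zero (0 : ℂ)]; exact hg.add hg'⟩
  smul_mem' := by
    rintro c p ⟨f, g, h, hf, hg⟩
    exact ⟨c • f, c • g, h.smul c, by rw [← smul_zero (A := ℂ) c]; exact hf.const_smul c,
      by rw [← smul_zero (A := ℂ) c]; exact hg.const_smul c⟩

/-- The relation `maxGraph` is single-valued, so that it is the graph of `kMax` below. -/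
theorem maxGraph_singleValued (p : L2 × L2) (hp : p ∈ maxGraph) (h0 : p.1 = 0) : p.2 = 0 := by
  obtain ⟨f, g, h⟩ := hp
  have hf0 : EqOn f 0 (Ioi 0) := by
    refine Measure.eqOn_open_of_ae_eq (μ := volume) ?_ isOpen_Ioi
      (fun x hx => (h.hasDeriv x hx).continuousAt.continuousWithinAt) continuousOn_const
    filter_upwards [h.ae_eq, Lp.coeFn_zero ℂ 2 (volume.restrict (Ioi (0 : ℝ)))] with x h1 h2
    rw [← h1, h0, h2]
  have hg0 : EqOn g 0 (Ioi 0) := by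
    intro x hx
    have h1 : HasDerivAt (0 : ℝ → ℂ) (g x) x :=
      (h.hasDeriv x hx).congr_of_eventuallyEq
        ((hf0.eventuallyEq_of_mem (Ioi_mem_nhds hx)).symm)
    exact h1.unique (hasDerivAt_const x 0)
  refine Lp.ext ?_
  filter_upwards [h.ae_hasDeriv, ae_restrict_mem measurableSet_Ioi,
    Lp.coeFn_zero ℂ 2 (volume.restrict (Ioi (0 : ℝ)))] with x h1 hx h2
  have h3 : HasDerivAt (0 : ℝ → ℂ) (-(p.2 x)) x :=
    h1.congr_of_eventuallyEq ((hg0.eventuallyEq_of_mem (Ioi_mem_nhds hx)).symm)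
  have h4 : -(p.2 x) = 0 := h3.unique (hasDerivAt_const x 0)
  rw [h2]
  simpa using h4

theorem minGraph_le_maxGraph : minGraph ≤ maxGraph := by
  rintro p ⟨f, g, h, -, -⟩
  exact ⟨f, g, h⟩

/-- The maximal operator `K_max = -d²/dx²` on `L²(0, ∞)`. -/
def kMax : L2 →ₗ.[ℂ] L2 := maxGraph.toLinearPMap

/-- The minimal operator `K_min = -d²/dx²` on `L²(0, ∞)`. -/
def kMin : L2 →ₗ.[ℂ] L2 := minGraph.toLinearPMap

theorem kMax_graph : kMax.graph = maxGraph :=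
  Submodule.toLinearPMap_graph_eq _ maxGraph_singleValued

theorem kMin_graph : kMin.graph = minGraph :=
  Submodule.toLinearPMap_graph_eq _
    fun p hp => maxGraph_singleValued p (minGraph_le_maxGraph hp)

/-- The element `x ↦ e^{c x}` of `L²(0, ∞)` (it is `0` when this function is not in `L²`). -/
def expVec (c : ℂ) : L2 :=
  open Classical in
  if h : MemLp (fun x : ℝ => Complex.exp (c * x)) 2 (volume.restrict (Ioi (0 : ℝ))) then h.toLp
  else 0

/-- The principal square root. -/
def csqrt (z : ℂ) : ℂ := z ^ (1 / 2 : ℂ)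

/-- The solution `e^{i √w x}` of `-f'' = w f`, square integrable for `w` in the upper half-plane. -/
def psi (w : ℂ) : L2 := expVec (Complex.I * csqrt w)

/-- The normalized solution `2^{1/4} e^{i √i x}` of `-f'' = i f`. -/
def phiPlus : L2 := (((2 : ℝ) ^ (1 / 4 : ℝ) : ℝ) : ℂ) • expVec (Complex.I * csqrt Complex.I)

/-- The normalized square integrable solution `2^{1/4} e^{-i √(-i) x}` of `-f'' = -i f`; the
principal root `√(-i)` lies in the lower half-plane, whence the sign. -/
def phiMinus : L2 :=
  (((2 : ℝ) ^ (1 / 4 : ℝ) : ℝ) : ℂ) • expVec (-(Complex.I * csqrt (-Complex.I)))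

/-- The extension `K_α` of `K_min`: the operator `-d²/dx²` with domain
`dom K_min + span {α φ⁻ - φ⁺}`. -/
def kExt (α : ℂ) : L2 →ₗ.[ℂ] L2 :=
  kMax.domRestrict (kMin.domain ⊔ Submodule.span ℂ {α • phiMinus - phiPlus})

end HalfLine

section General

variable {H : Type*} [NormedAddCommGroup H] [InnerProductSpace ℂ H]

/-- The defect space `ran (T - w̄)ᗮ = ker (T* - w)` of an operator `T`. -/
def defectSpace (T : H →ₗ.[ℂ] H) (w : ℂ) : Submodule ℂ H :=
  (LinearMap.range (T.toFun - (starRingEnd ℂ w) • T.domain.subtype))ᗮ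

/-- For an operator `T` with deficiency indices `(1, 1)`: `ψ w` is a basis of the defect space at
each `w` in the upper half-plane, and `p`, `m` are orthonormal bases of the defect spaces at
`i` and `-i`. -/
structure IsDefectBasis (T : H →ₗ.[ℂ] H) (ψ : ℂ → H) (p m : H) : Prop where
  ne_zero : ∀ w : ℂ, 0 < w.im → ψ w ≠ 0
  span_eq : ∀ w : ℂ, 0 < w.im → defectSpace T w = Submodule.span ℂ {ψ w}
  norm_pos : ‖p‖ = 1
  span_pos : defectSpace T Complex.I = Submodule.span ℂ {p}
  norm_neg : ‖m‖ = 1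
  span_neg : defectSpace T (-Complex.I) = Submodule.span ℂ {m}

/-- The Livsic characteristic function `B(w) = (w - i)/(w + i) · A(w, i)⁻¹ A(w, -i)` where
`A(w, ±i)` is the inner product of `ψ w` with the normalized defect vector at `±i` (linear in
`ψ w`, which is the second argument of Mathlib's inner product). -/
def livsic (ψ : ℂ → H) (p m : H) (w : ℂ) : ℂ :=
  (w - Complex.I) / (w + Complex.I) * (inner ℂ p (ψ w))⁻¹ * inner ℂ m (ψ w)

end General

/-- The contractive analytic functions on the upper half-plane. -/
def IsSchurUpper (B : ℂ → ℂ) : Prop :=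
  DifferentiableOn ℂ B {w | 0 < w.im} ∧ ∀ w : ℂ, 0 < w.im → ‖B w‖ ≤ 1

theorem ofReal_add_I_ne_zero (s : ℝ) : (s : ℂ) + Complex.I ≠ 0 := by
  intro h
  simpa using congrArg Complex.im h

/-- The Cayley transform `s ↦ (s - i)/(s + i)` from the real line to the unit circle. -/
def cayleyReal (s : ℝ) : Metric.sphere (0 : ℂ) 1 :=
  ⟨((s : ℂ) - Complex.I) / (s + Complex.I), by
    have h : (s : ℂ) - Complex.I = (starRingEnd ℂ) ((s : ℂ) + Complex.I) := by simp [sub_eq_add_neg]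
    rw [mem_sphere_zero_iff_norm, norm_div, h, RCLike.norm_conj,
      div_self (norm_ne_zero_iff.mpr (ofReal_add_I_ne_zero s))]⟩

/-- The inverse Cayley transform `z ↦ i (1 + z)/(1 - z)`, from the disk to the upper half-plane. -/
def cayleyInv (z : ℂ) : ℂ := Complex.I * (1 + z) / (1 - z)

/-- `ν` is the Clark measure on the unit circle of `b` with parameter `α`: the Poisson integral of
`ν` is the real part of `(α + b)/(α - b)`, that is, `(1 - |b|²)/|α - b|²`. -/
def IsCircleClarkMeasure (b : ℂ → ℂ) (α : ℂ) (ν : Measure (Metric.sphere (0 : ℂ) 1)) : Prop :=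
  IsFiniteMeasure ν ∧ ∀ z : ℂ, ‖z‖ < 1 →
    ∫ t, (1 - ‖z‖ ^ 2) / ‖(t : ℂ) - z‖ ^ 2 ∂ν = ((α + b z) / (α - b z)).re

/-- `μ` is the Clark measure on the real line of the function `B` on the upper half-plane with
parameter `α`: the pullback under the Cayley transform of the Clark measure on the circle of the
function `b` with `B = b ∘ γ`. -/
def IsClarkMeasure (B : ℂ → ℂ) (α : ℂ) (μ : Measure ℝ) : Prop :=
  ∃ ν : Measure (Metric.sphere (0 : ℂ) 1),
    IsCircleClarkMeasure (fun z => B (cayleyInv z)) α ν ∧ μ = ν.comap cayleyReal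

namespace HalfLine

/-- The explicit polynomial in `s^{1/2}` in the denominator of the density. -/
def denomD (α : ℂ) (s : ℝ) : ℂ :=
  2 * (1 - (α.re : ℂ)) * (s : ℂ) ^ 2 + 2 * ((|s| : ℝ) : ℂ) + ((‖Complex.I * α - 1‖ ^ 2 : ℝ) : ℂ)
    - (((2 : ℝ) ^ (3 / 2 : ℝ) : ℝ) : ℂ) * (1 - (α.re : ℂ)) * (s : ℂ) ^ (3 / 2 : ℂ)
    + 2 * (1 - (α.re : ℂ) + (α.im : ℂ)) * (s : ℂ)
    - (((2 : ℝ) ^ (3 / 2 : ℝ) : ℝ) : ℂ) * (1 + (α.im : ℂ)) * (s : ℂ) ^ (1 / 2 : ℂ)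

/-- The density `2 Re √(2s) / (π (|s| + 1 + 2 Re (√s e^{-iπ/4})) D(s))`. -/
def weight (α : ℂ) (s : ℝ) : ℂ :=
  ((2 * (csqrt (2 * (s : ℂ))).re : ℝ) : ℂ) /
    (((Real.pi * (|s| + 1 +
        2 * (csqrt (s : ℂ) * Complex.exp (-(Complex.I * Real.pi / 4))).re) : ℝ) : ℂ) * denomD α s)

end HalfLine

end

/-!
On the half-line, variation of constants solves `-f'' - w̄ f = g` with `f(0) = f'(0) = 0`, and the
solution is square integrable precisely when `g` is orthogonal to the decaying exponential `ψ(w)`.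
So `ran (K_min - w̄)` is the orthogonal complement of `ψ(w)`, which gives the defect spaces, and a
symmetric extension of `K_min` by the vector `α φ⁻ - φ⁺` with `|α| = 1` has full ranges at `±i`,
hence is self-adjoint.

With `ζ = e^{iπ/4}`, factoring `w ± i` through `√w` reduces the Livšic function to
`B(w) = (√w - ζ) / (√w + ζ̄)`, a Möbius transform of `√w` mapping the right half-plane into the unit
disc. So `B` extends, injective and bounded by `1`, to the closed upper half-plane. Herglotz's
theorem represents `(α + b) / (α - b)` by the Clark measure, and this function has continuous
boundary values on the circle away from the point `γ(∞) = 1`, the branch point `γ(0) = -1` and the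
at most one point where `b = α`. Off these finitely many points the Clark measure has the boundary
value of the Poisson integral as density; pulling back by `γ` multiplies it by the Cauchy density.
-/

noncomputable section

section IntervalIntegral

variable {E : Type*} [NormedAddCommGroup E]

theorem integrableOn_Ioc_of_tendsto_nhdsGT {g : ℝ → E} {a b : ℝ} {l : E}
    (hg : ContinuousOn g (Ioc a b)) (hl : Tendsto g (𝓝[>] a) (𝓝 l)) :
    IntegrableOn g (Ioc a b) := by
  have hcont : ContinuousOn (Function.update g a l) (Icc a b) := by
    rw [continuousOn_update_iff, Icc_sdiff_left]
    exact ⟨hg, fun _ => hl.mono_left (nhdsWithin_mono a Ioc_subset_Ioi_self)⟩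
  refine ((hcont.integrableOn_Icc).mono_set Ioc_subset_Icc_self).congr_fun (fun x hx => ?_)
    measurableSet_Ioc
  exact Function.update_of_ne hx.1.ne' l g

variable [NormedSpace ℝ E]

theorem absolutelyContinuousOnInterval_intervalIntegral {p : ℝ → E} {a b c : ℝ}
    (hp : IntervalIntegrable p volume a b) (hc : c ∈ uIcc a b) :
    AbsolutelyContinuousOnInterval (fun x => ∫ t in c..x, p t) a b := by
  have hnorm := hp.norm.absolutelyContinuousOnInterval_intervalIntegral hc
  rw [absolutelyContinuousOnInterval_iff] at hnorm ⊢
  refine fun ε hε => (hnorm ε hε).imp fun δ ⟨hδ, H⟩ => ⟨hδ, fun I hI hlt =>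
    (Finset.sum_le_sum fun i hi => ?_).trans_lt (H I hI hlt)⟩
  have hInt : ∀ x ∈ uIcc a b, IntervalIntegrable p volume c x := fun x hx =>
    hp.mono_set (uIcc_subset_uIcc hc hx)
  obtain ⟨h₁, h₂⟩ := hI.1 i hi
  rw [dist_eq_norm, dist_eq_norm, intervalIntegral.integral_interval_sub_left (hInt _ h₁)
    (hInt _ h₂), intervalIntegral.integral_interval_sub_left (hInt _ h₁).norm (hInt _ h₂).norm,
    Real.norm_eq_abs]
  exact intervalIntegral.norm_integral_le_abs_integral_norm

theorem integral_eq_sub_of_absolutelyContinuousOnInterval [CompleteSpace E] {f p : ℝ → E}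
    {a b : ℝ} (hf : AbsolutelyContinuousOnInterval f a b)
    (hd : ∀ᵐ x, x ∈ uIcc a b → HasDerivAt f (p x) x) (hp : IntervalIntegrable p volume a b) :
    ∫ x in a..b, p x = f b - f a := by
  obtain ⟨C, hC⟩ := (hf.sub (absolutelyContinuousOnInterval_intervalIntegral hp
    left_mem_uIcc)).const_of_ae_hasDerivAt_zero (by
      filter_upwards [hd, hp.ae_hasDerivAt_integral] with x hfx hpx hx
      simpa using! (hfx hx).sub (hpx hx a left_mem_uIcc))
  have hab := (hC a left_mem_uIcc).trans (hC b right_mem_uIcc).symm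
  simp only [Pi.sub_apply, intervalIntegral.integral_same, sub_zero] at hab
  rw [hab, sub_sub_cancel]

theorem frequently_deriv_lt_of_integrableOn_Ioi {φ φ' : ℝ → ℝ} {a c : ℝ} (hc : 0 < c)
    (hφ : ∀ x, a < x → HasDerivAt φ (φ' x) x) (hi : IntegrableOn φ (Ioi a)) :
    ∃ᶠ x in atTop, φ' x < c := by
  intro hφ'
  obtain ⟨b, hb⟩ := eventually_atTop.mp (hφ'.and (eventually_gt_atTop a))
  have hgrow : ∀ x, b ≤ x → φ b + c * (x - b) ≤ φ x := by
    intro x hx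
    have hder : ∀ y ∈ Ici b, HasDerivAt φ (φ' y) y := fun y hy => hφ y (hb y hy).2
    have := (convex_Ici b).mul_sub_le_image_sub_of_le_deriv (f := φ)
      (fun y hy => (hder y hy).continuousAt.continuousWithinAt)
      (fun y hy => (hder y (interior_subset hy)).differentiableAt.differentiableWithinAt)
      (fun y hy => (hder y (interior_subset hy)).deriv ▸ not_lt.mp (hb y (interior_subset hy)).1)
      b self_mem_Ici x hx hx
    linarith
  have hone : ∀ᶠ x in atTop, 1 ≤ φ x := by
    filter_upwards [eventually_ge_atTop b, eventually_ge_atTop (b + (1 - φ b) / c)] with x hx hx'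
    have : (1 - φ b) / c * c ≤ (x - b) * c := by gcongr; linarith
    rw [div_mul_cancel₀ _ hc.ne'] at this
    linarith [hgrow x hx]
  obtain ⟨d, hd⟩ := eventually_atTop.mp (hone.and (eventually_gt_atTop a))
  have hconst : IntegrableOn (fun _ : ℝ => (1 : ℝ)) (Ici d) := by
    refine Integrable.mono (hi.mono_set fun x hx => (hd x hx).2) aestronglyMeasurable_const ?_
    filter_upwards [ae_restrict_mem measurableSet_Ici] with x hx
    rw [norm_one]
    exact (hd x hx).1.trans (Real.le_norm_self _)
  simp [integrableOn_const_iff] at hconst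

end IntervalIntegral

namespace HalfLine

namespace ACLoc

variable {f g p : ℝ → ℂ}

theorem mul (hf : ACLoc f) (hg : ACLoc g) : ACLoc (fun x => f x * g x) :=
  fun a b ha hab => (hf a b ha hab).smul (hg a b ha hab)

theorem of_contDiff (hf : ContDiff ℝ 1 f) : ACLoc f :=
  fun _ _ _ _ => hf.contDiffOn.absolutelyContinuousOnInterval

theorem star (hf : ACLoc f) : ACLoc (fun x => star (f x)) := by
  intro a b ha hab
  have h := hf a b ha hab
  rw [absolutelyContinuousOnInterval_iff] at h ⊢
  simpa only [Complex.star_def, Complex.dist_conj_conj] using h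

theorem intervalIntegral (hp : LocallyIntegrable p volume) :
    ACLoc (fun x => ∫ t in (0 : ℝ)..x, p t) := fun a b ha hab =>
  (absolutelyContinuousOnInterval_intervalIntegral
    (hp.integrableOn_isCompact isCompact_uIcc).intervalIntegrable left_mem_uIcc).mono
      (uIcc_subset_uIcc_right (by rw [uIcc_of_le (ha.le.trans hab)]; exact ⟨ha.le, hab⟩))

theorem continuousOn (hf : ACLoc f) : ContinuousOn f (Ioi 0) := by
  intro x (hx : 0 < x)
  have h := (hf (x / 2) (2 * x) (by linarith) (by linarith)).continuousOn
  rw [uIcc_of_le (by linarith)] at h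
  exact (h.continuousAt (Icc_mem_nhds (by linarith) (by linarith))).continuousWithinAt

theorem integral_eq_sub (hf : ACLoc f)
    (hd : ∀ᵐ x ∂(volume.restrict (Ioi (0 : ℝ))), HasDerivAt f (p x) x)
    {a b : ℝ} (ha : 0 < a) (hab : a ≤ b) (hp : IntervalIntegrable p volume a b) :
    ∫ x in a..b, p x = f b - f a := by
  refine integral_eq_sub_of_absolutelyContinuousOnInterval (hf a b ha hab) ?_ hp
  filter_upwards [(ae_restrict_iff' measurableSet_Ioi).mp hd] with x hx h
  rw [uIcc_of_le hab] at h
  exact hx (ha.trans_le h.1)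

theorem eq_add_integral {f₀ : ℂ} (hf : ACLoc f)
    (hd : ∀ᵐ x ∂(volume.restrict (Ioi (0 : ℝ))), HasDerivAt f (p x) x)
    (h0 : Tendsto f (𝓝[>] 0) (𝓝 f₀)) {X : ℝ} (hX : 0 < X)
    (hp : IntervalIntegrable p volume 0 X) : f X = f₀ + ∫ x in (0 : ℝ)..X, p x := by
  have hprim : Tendsto (fun a => ∫ x in X..a, p x) (𝓝[>] 0) (𝓝 (∫ x in X..(0 : ℝ), p x)) := by
    have hc := intervalIntegral.continuousOn_primitive_interval' hp right_mem_uIcc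
    rw [uIcc_of_le hX.le] at hc
    refine (hc 0 ⟨le_rfl, hX.le⟩).tendsto.mono_left ?_
    rw [← nhdsWithin_Ioc_eq_nhdsGT hX]
    exact nhdsWithin_mono _ Ioc_subset_Icc_self
  have hsub : (fun a => ∫ x in X..a, p x) =ᶠ[𝓝[>] 0] fun a => f a - f X := by
    rw [← nhdsWithin_Ioc_eq_nhdsGT hX]
    filter_upwards [self_mem_nhdsWithin] with a ha
    rw [intervalIntegral.integral_symm, hf.integral_eq_sub hd ha.1 ha.2 (hp.mono_set ?_), neg_sub]
    exact uIcc_subset_uIcc_right (by rw [uIcc_of_le hX.le]; exact ⟨ha.1.le, ha.2⟩)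
  have hlim := tendsto_nhds_unique (hprim.congr' hsub) (h0.sub_const _)
  rw [intervalIntegral.integral_symm] at hlim
  linear_combination hlim

theorem integral_Ioi_eq {f₀ : ℂ} (hf : ACLoc f)
    (hd : ∀ᵐ x ∂(volume.restrict (Ioi (0 : ℝ))), HasDerivAt f (p x) x)
    (hp : IntegrableOn p (Ioi 0)) (hi : IntegrableOn f (Ioi 0))
    (h0 : Tendsto f (𝓝[>] 0) (𝓝 f₀)) : ∫ x in Ioi (0 : ℝ), p x = -f₀ := by
  have hlim : Tendsto f atTop (𝓝 (f₀ + ∫ x in Ioi (0 : ℝ), p x)) := by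
    refine ((intervalIntegral_tendsto_integral_Ioi 0 hp tendsto_id).const_add f₀).congr' ?_
    filter_upwards [eventually_gt_atTop 0] with X hX
    refine (hf.eq_add_integral hd h0 hX ?_).symm
    rw [intervalIntegrable_iff_integrableOn_Ioc_of_le hX.le]
    exact hp.mono_set Ioc_subset_Ioi_self
  have hzero := IntegrableAtFilter.eq_zero_of_tendsto (μ := volume) ⟨Ioi 0, Ioi_mem_atTop 0, hi⟩
    (fun s hs => by
      obtain ⟨b, hb⟩ := mem_atTop_sets.mp hs
      exact measure_mono_top (fun x hx => hb x hx) (Real.volume_Ici (a := b))) hlim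
  linear_combination hzero

end ACLoc

namespace IsRep

variable {f g f' g' : ℝ → ℂ} {u v u' v' : L2} {a b a' b' : ℂ}

theorem memLp (h : IsRep f g u v) : MemLp f 2 (volume.restrict (Ioi (0 : ℝ))) :=
  (memLp_congr_ae h.ae_eq).mp (Lp.memLp u)

theorem ae_hasDerivAt_mul_star (h : IsRep f g u v) (h' : IsRep f' g' u' v') :
    ∀ᵐ x ∂(volume.restrict (Ioi (0 : ℝ))), HasDerivAt (fun x => g x * star (f' x))
      (g x * star (g' x) - v x * star (f' x)) x := by
  filter_upwards [h.ae_hasDeriv, ae_restrict_mem measurableSet_Ioi] with x hx hpos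
  exact (hx.fun_mul (h'.hasDeriv x hpos).star).congr_deriv (by ring)

theorem intervalIntegrable_norm_sq_deriv (h : IsRep f g u v) (hg : Tendsto g (𝓝[>] 0) (𝓝 b))
    {X : ℝ} (hX : 0 < X) : IntervalIntegrable (fun x => ‖g x‖ ^ 2) volume 0 X := by
  rw [intervalIntegrable_iff_integrableOn_Ioc_of_le hX.le]
  exact integrableOn_Ioc_of_tendsto_nhdsGT
    ((h.ac_deriv.continuousOn.mono Ioc_subset_Ioi_self).norm.pow 2) (hg.norm.pow 2)

theorem exists_integral_norm_sq_deriv_le (h : IsRep f g u v) (hf : Tendsto f (𝓝[>] 0) (𝓝 a))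
    (hg : Tendsto g (𝓝[>] 0) (𝓝 b)) :
    ∃ C : ℝ, ∀ X : ℝ, 0 < X → ∫ x in (0 : ℝ)..X, ‖g x‖ ^ 2 ≤ (g X * star (f X)).re + C := by
  have hvf : IntegrableOn (fun x => v x * star (f x)) (Ioi 0) :=
    (Lp.memLp v).integrable_mul h.memLp.star
  refine ⟨‖b * star a‖ + ∫ x in Ioi (0 : ℝ), ‖v x * star (f x)‖, fun X hX => ?_⟩
  have hsq := h.intervalIntegrable_norm_sq_deriv hg hX
  have hgg : ∀ x, g x * star (g x) = ((‖g x‖ ^ 2 : ℝ) : ℂ) := fun x => by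
    rw [Complex.star_def, Complex.mul_conj, Complex.normSq_eq_norm_sq]
  have hgi : IntervalIntegrable (fun x => g x * star (g x)) volume 0 X := by
    simp only [hgg]
    exact ⟨hsq.1.ofReal, hsq.2.ofReal⟩
  have hvi : IntervalIntegrable (fun x => v x * star (f x)) volume 0 X := by
    rw [intervalIntegrable_iff_integrableOn_Ioc_of_le hX.le]
    exact hvf.mono_set Ioc_subset_Ioi_self
  have hparts := (h.ac_deriv.mul h.ac.star).eq_add_integral (h.ae_hasDerivAt_mul_star h)
    (hg.mul hf.star) hX (hgi.sub hvi)
  rw [intervalIntegral.integral_sub hgi hvi] at hparts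
  simp only [hgg, intervalIntegral.integral_ofReal] at hparts
  have hre := congrArg Complex.re hparts
  simp only [Complex.add_re, Complex.sub_re, Complex.ofReal_re] at hre
  have hv_le : ‖∫ x in (0 : ℝ)..X, v x * star (f x)‖ ≤
      ∫ x in Ioi (0 : ℝ), ‖v x * star (f x)‖ := by
    refine (intervalIntegral.norm_integral_le_integral_norm hX.le).trans ?_
    rw [intervalIntegral.integral_of_le hX.le]
    exact setIntegral_mono_set hvf.norm (Eventually.of_forall fun _ => norm_nonneg _)
      Ioc_subset_Ioi_self.eventuallyLE
  have hv_re := (Complex.re_le_norm _).trans hv_le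
  have hab_re := (abs_le.mp (Complex.abs_re_le_norm (b * star a))).1
  linarith

theorem memLp_deriv (h : IsRep f g u v) (hf : Tendsto f (𝓝[>] 0) (𝓝 a))
    (hg : Tendsto g (𝓝[>] 0) (𝓝 b)) : MemLp g 2 (volume.restrict (Ioi (0 : ℝ))) := by
  rw [memLp_two_iff_integrable_sq_norm
    (h.ac_deriv.continuousOn.aestronglyMeasurable measurableSet_Ioi)]
  obtain ⟨C, hC⟩ := h.exists_integral_norm_sq_deriv_le hf hg
  have hfreq : ∃ᶠ X in atTop, 2 * (g X * star (f X)).re < 2 :=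
    frequently_deriv_lt_of_integrableOn_Ioi two_pos
      (fun x hx => by simpa only [Complex.inner, mul_comm] using! (h.hasDeriv x hx).norm_sq)
      ((memLp_two_iff_integrable_sq_norm h.memLp.1).mp h.memLp)
  have hbdd : ∀ X, 0 < X → ∫ x in (0 : ℝ)..X, ‖g x‖ ^ 2 ≤ C + 1 := by
    intro X hX
    obtain ⟨Y, hY, hXY⟩ := (hfreq.and_eventually (eventually_ge_atTop X)).exists
    have hmono := intervalIntegral.integral_mono_interval le_rfl hX.le hXY
      (Eventually.of_forall fun x => sq_nonneg ‖g x‖)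
      (h.intervalIntegrable_norm_sq_deriv hg (hX.trans_le hXY))
    linarith [hC Y (hX.trans_le hXY)]
  refine integrableOn_Ioi_of_intervalIntegral_norm_bounded (l := atTop)
    (b := fun X : ℝ => max X 1) (C + 1) 0 (fun X => ?_)
    (tendsto_atTop_mono (fun X => le_max_left X 1) tendsto_id) (Eventually.of_forall fun X => ?_)
  · exact (h.intervalIntegrable_norm_sq_deriv hg (lt_max_of_lt_right one_pos)).1
  · simpa only [norm_pow, norm_norm] using hbdd _ (lt_max_of_lt_right one_pos)

theorem green_identity (h : IsRep f g u v) (h' : IsRep f' g' u' v')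
    (hf : Tendsto f (𝓝[>] 0) (𝓝 a)) (hg : Tendsto g (𝓝[>] 0) (𝓝 b))
    (hf' : Tendsto f' (𝓝[>] 0) (𝓝 a')) (hg' : Tendsto g' (𝓝[>] 0) (𝓝 b')) :
    inner ℂ u' v - inner ℂ v' u = b * star a' - a * star b' := by
  have hgL := h.memLp_deriv hf hg
  have hgL' := h'.memLp_deriv hf' hg'
  have hderiv : ∀ᵐ x ∂(volume.restrict (Ioi (0 : ℝ))),
      HasDerivAt (fun x => g x * star (f' x) + (-1 : ℂ) • (f x * star (g' x)))
        (-(v x * star (f' x) - f x * star (v' x))) x := by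
    filter_upwards [h.ae_hasDerivAt_mul_star h', h'.ae_hasDerivAt_mul_star h] with x hx hx'
    refine (hx.add ((hx'.star.congr_of_eventuallyEq
      (.of_forall fun y => ?_)).const_smul (-1 : ℂ))).congr_deriv ?_
    · simp [mul_comm]
    · simp only [star_sub, star_mul', star_star, smul_eq_mul]
      ring
  have hgreen := ((h.ac_deriv.mul h'.ac.star).add
      ((h.ac.mul h'.ac_deriv.star).smul (-1))).integral_Ioi_eq hderiv
    (((Lp.memLp v).integrable_mul h'.memLp.star).sub
      (h.memLp.integrable_mul (Lp.memLp v').star)).neg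
    ((hgL.integrable_mul h'.memLp.star).add ((h.memLp.integrable_mul hgL'.star).smul (-1 : ℂ)))
    ((hg.mul hf'.star).add ((hf.mul hg'.star).const_smul (-1 : ℂ)))
  rw [integral_neg, neg_inj, smul_eq_mul, neg_one_mul, ← sub_eq_add_neg] at hgreen
  rw [L2.inner_def, L2.inner_def, ← integral_sub (L2.integrable_inner _ _)
    (L2.integrable_inner _ _), ← hgreen]
  refine integral_congr_ae ?_
  filter_upwards [h.ae_eq, h'.ae_eq] with x hx hx'
  simp only [RCLike.inner_apply, hx, hx', starRingEnd_apply]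

end IsRep

end HalfLine

section Young

variable {G : Type*} [MeasurableSpace G] [AddGroup G] [MeasurableAdd₂ G] [MeasurableNeg G]
  {μ : Measure G} [SFinite μ] [μ.IsAddLeftInvariant] [μ.IsAddRightInvariant] [μ.IsNegInvariant]
  {K g : G → ENNReal} {p : ℝ}

theorem lintegral_mul_rpow_le {α : Type*} [MeasurableSpace α] {μ : Measure α} {K g : α → ENNReal}
    (hK : AEMeasurable K μ) (hg : AEMeasurable g μ) (hp : 1 ≤ p) :
    (∫⁻ t, K t * g t ∂μ) ^ p ≤ (∫⁻ t, K t ∂μ) ^ (p - 1) * ∫⁻ t, K t * g t ^ p ∂μ := by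
  have hp0 : 0 < p := one_pos.trans_le hp
  have h := eLpNorm'_le_eLpNorm'_mul_rpow_measure_univ (μ := μ.withDensity K) one_pos hp
    (hg.mono_ac (withDensity_absolutelyContinuous μ K)).aestronglyMeasurable
  simp only [eLpNorm', enorm_eq_self, ENNReal.rpow_one, div_one,
    withDensity_apply _ MeasurableSet.univ, Measure.restrict_univ] at h
  rw [lintegral_withDensity_eq_lintegral_mul₀ hK hg,
    lintegral_withDensity_eq_lintegral_mul₀ hK (hg.pow_const p)] at h
  calc _ ≤ _ := ENNReal.rpow_le_rpow h hp0.le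
    _ = _ := by
      rw [ENNReal.mul_rpow_of_nonneg _ _ hp0.le, ← ENNReal.rpow_mul, ← ENNReal.rpow_mul,
        one_div_mul_cancel hp0.ne', sub_mul, one_div_mul_cancel hp0.ne', one_mul,
        ENNReal.rpow_one, mul_comm]
      rfl

theorem lintegral_rpow_lconvolution_le (hK : Measurable K) (hg : AEMeasurable g μ) (hp : 1 ≤ p) :
    ∫⁻ x, (∫⁻ t, K (x - t) * g t ∂μ) ^ p ∂μ ≤ (∫⁻ x, K x ∂μ) ^ p * ∫⁻ t, g t ^ p ∂μ := by
  set C := ∫⁻ x, K x ∂μ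
  have hK₂ : AEMeasurable (fun z : G × G => K (z.1 - z.2) * g z.2 ^ p) (μ.prod μ) :=
    (hK.comp (measurable_fst.sub measurable_snd)).aemeasurable.mul (hg.pow_const p).comp_snd
  calc ∫⁻ x, (∫⁻ t, K (x - t) * g t ∂μ) ^ p ∂μ
      ≤ ∫⁻ x, C ^ (p - 1) * ∫⁻ t, K (x - t) * g t ^ p ∂μ ∂μ := by
        refine lintegral_mono fun x => ?_
        have h := lintegral_mul_rpow_le (hK.comp (measurable_const.sub measurable_id)).aemeasurable
          hg hp (K := fun t => K (x - t))
        rwa [lintegral_sub_left_eq_self K x] at h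
    _ = C ^ (p - 1) * ∫⁻ t, ∫⁻ x, K (x - t) * g t ^ p ∂μ ∂μ := by
        rw [lintegral_const_mul'' _ hK₂.lintegral_prod_right', lintegral_lintegral_swap hK₂]
    _ = C ^ (p - 1) * (C * ∫⁻ t, g t ^ p ∂μ) := by
        rw [← lintegral_const_mul'' _ (hg.pow_const p)]
        congr 1
        refine lintegral_congr fun t => ?_
        rw [lintegral_mul_const _ (by fun_prop : Measurable fun x => K (x - t)),
          lintegral_sub_right_eq_self K t]
    _ = C ^ p * ∫⁻ t, g t ^ p ∂μ := by
        nth_rewrite 2 [← ENNReal.rpow_one C]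
        rw [← mul_assoc, ← ENNReal.rpow_add_of_nonneg _ _ (sub_nonneg.mpr hp) zero_le_one,
          sub_add_cancel]

theorem memLp_of_enorm_le_lconvolution {E F : Type*} [NormedAddCommGroup E] [NormedAddCommGroup F]
    {s : Set G} {u : G → E} {v : G → F} {q : ENNReal} (hq : 1 ≤ q) (hq' : q ≠ ⊤)
    (hK : Measurable K) (hK' : ∫⁻ x, K x ∂μ ≠ ⊤) (hu : AEStronglyMeasurable u (μ.restrict s))
    (hv : MemLp v q μ) (h : ∀ᵐ x ∂μ.restrict s, ‖u x‖ₑ ≤ ∫⁻ t, K (x - t) * ‖v t‖ₑ ∂μ) :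
    MemLp u q (μ.restrict s) := by
  have hq0 : q ≠ 0 := (one_pos.trans_le hq).ne'
  refine ⟨hu, (eLpNorm_lt_top_iff_lintegral_rpow_enorm_lt_top hq0 hq').mpr ?_⟩
  have hvq := (eLpNorm_lt_top_iff_lintegral_rpow_enorm_lt_top hq0 hq').mp hv.2
  calc ∫⁻ x in s, ‖u x‖ₑ ^ q.toReal ∂μ
      ≤ ∫⁻ x in s, (∫⁻ t, K (x - t) * ‖v t‖ₑ ∂μ) ^ q.toReal ∂μ :=
        lintegral_mono_ae (h.mono fun x hx => ENNReal.rpow_le_rpow hx ENNReal.toReal_nonneg)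
    _ ≤ ∫⁻ x, (∫⁻ t, K (x - t) * ‖v t‖ₑ ∂μ) ^ q.toReal ∂μ := setLIntegral_le_lintegral _ _
    _ ≤ (∫⁻ x, K x ∂μ) ^ q.toReal * ∫⁻ t, ‖v t‖ₑ ^ q.toReal ∂μ :=
        lintegral_rpow_lconvolution_le hK hv.1.enorm
          (ENNReal.toReal_one ▸ ENNReal.toReal_mono hq' hq)
    _ < ⊤ := ENNReal.mul_lt_top (ENNReal.rpow_lt_top_of_nonneg ENNReal.toReal_nonneg hK') hvq

end Young

theorem lintegral_exp_neg_mul_abs_ne_top {κ : ℝ} (hκ : 0 < κ) :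
    ∫⁻ x : ℝ, ENNReal.ofReal (Real.exp (-κ * |x|)) ≠ ⊤ := by
  have hInt : Integrable fun x : ℝ => Real.exp (-κ * |x|) := by
    refine Integrable.of_integral_ne_zero ?_
    rw [integral_comp_abs (f := fun x => Real.exp (-κ * x)),
      integral_exp_mul_Ioi (neg_lt_zero.mpr hκ)]
    simp [hκ.ne']
  exact hInt.lintegral_lt_top.ne

theorem hasDerivAt_exp_mul_ofReal (k : ℂ) (x : ℝ) :
    HasDerivAt (fun x : ℝ => Complex.exp (k * x)) (k * Complex.exp (k * x)) x := by
  have h : HasDerivAt (fun x : ℝ => k * (x : ℂ)) k x := by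
    simpa using (Complex.ofRealCLM.hasDerivAt (x := x)).const_mul k
  exact h.cexp.congr_deriv (mul_comm _ _)

theorem contDiff_exp_mul_ofReal (k : ℂ) : ContDiff ℝ 1 fun x : ℝ => Complex.exp (k * x) :=
  (contDiff_const.mul Complex.ofRealCLM.contDiff).cexp

theorem enorm_exp_mul_ofReal (k : ℂ) (x : ℝ) :
    ‖Complex.exp (k * x)‖ₑ = ENNReal.ofReal (Real.exp (k.re * x)) := by
  rw [← ofReal_norm, Complex.norm_exp, Complex.re_mul_ofReal]

namespace HalfLine

theorem memLp_exp {c : ℂ} (hc : c.re < 0) :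
    MemLp (fun x : ℝ => Complex.exp (c * x)) 2 (volume.restrict (Ioi (0 : ℝ))) := by
  rw [memLp_two_iff_integrable_sq_norm (by fun_prop)]
  refine (integrableOn_exp_mul_Ioi (a := 2 * c.re) (by linarith) 0).congr_fun (fun x _ => ?_)
    measurableSet_Ioi
  simp only [Complex.norm_exp, Complex.re_mul_ofReal]
  rw [← Real.exp_nat_mul, Nat.cast_ofNat, mul_assoc]

/-- The solution of `y' = k y + g`, `y(0) = 0`, given by variation of constants. -/
def duhamel (k : ℂ) (g : ℝ → ℂ) (x : ℝ) : ℂ :=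
  Complex.exp (k * x) * ∫ t in (0 : ℝ)..x, Complex.exp (-k * t) * g t

section Duhamel

variable {k : ℂ} {g : ℝ → ℂ}

theorem duhamel_zero : duhamel k g 0 = 0 := by
  simp [duhamel]

theorem locallyIntegrable_exp_mul (hg : LocallyIntegrable g volume) (k : ℂ) :
    LocallyIntegrable (fun t : ℝ => Complex.exp (k * t) * g t) volume :=
  hg.continuous_smul (contDiff_exp_mul_ofReal k).continuous

theorem acLoc_duhamel (hg : LocallyIntegrable g volume) : ACLoc (duhamel k g) :=
  (ACLoc.of_contDiff (contDiff_exp_mul_ofReal k)).mul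
    (ACLoc.intervalIntegral (locallyIntegrable_exp_mul hg (-k)))

theorem continuous_duhamel (hg : LocallyIntegrable g volume) : Continuous (duhamel k g) :=
  (contDiff_exp_mul_ofReal k).continuous.mul (intervalIntegral.continuous_primitive (fun _ _ =>
    ((locallyIntegrable_exp_mul hg (-k)).integrableOn_isCompact isCompact_uIcc).intervalIntegrable)
    0)

theorem hasDerivAt_duhamel_of_hasDerivAt_integral {x : ℝ}
    (h : HasDerivAt (fun x => ∫ t in (0 : ℝ)..x, Complex.exp (-k * t) * g t)
      (Complex.exp (-k * x) * g x) x) :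
    HasDerivAt (duhamel k g) (k * duhamel k g x + g x) x := by
  refine ((hasDerivAt_exp_mul_ofReal k x).fun_mul h).congr_deriv ?_
  have hexp : Complex.exp (k * x) * Complex.exp (-k * x) = 1 := by
    rw [← Complex.exp_add, neg_mul, add_neg_cancel, Complex.exp_zero]
  rw [duhamel]
  linear_combination g x * hexp

theorem ae_hasDerivAt_duhamel (hg : LocallyIntegrable g volume) :
    ∀ᵐ x, HasDerivAt (duhamel k g) (k * duhamel k g x + g x) x := by
  filter_upwards [LocallyIntegrable.ae_hasDerivAt_integral (locallyIntegrable_exp_mul hg (-k))]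
    with x hx using hasDerivAt_duhamel_of_hasDerivAt_integral (hx 0)

theorem hasDerivAt_duhamel (hg : Continuous g) (x : ℝ) :
    HasDerivAt (duhamel k g) (k * duhamel k g x + g x) x := by
  have hc : Continuous fun t : ℝ => Complex.exp (-k * t) * g t := by fun_prop
  exact hasDerivAt_duhamel_of_hasDerivAt_integral (intervalIntegral.integral_hasDerivAt_right
    (hc.intervalIntegrable _ _) (hc.stronglyMeasurableAtFilter _ _) hc.continuousAt)

theorem memLp_of_eq_integral_exp_mul {f : ℝ → ℂ} (hk : k.re ≠ 0)
    (hf : AEStronglyMeasurable f (volume.restrict (Ioi 0)))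
    (hg : MemLp g 2 (volume.restrict (Ioi (0 : ℝ)))) {s : ℝ → Set ℝ}
    (hs : ∀ x, MeasurableSet (s x)) (hs_pos : ∀ x, s x ⊆ Ioi 0)
    (hdecay : ∀ x, ∀ t ∈ s x, k.re * (x - t) ≤ -|k.re| * |x - t|)
    (h : ∀ x, 0 < x → ‖f x‖ = ‖∫ t in s x, Complex.exp (k * x) * (Complex.exp (-k * t) * g t)‖) :
    MemLp f 2 (volume.restrict (Ioi 0)) := by
  refine memLp_of_enorm_le_lconvolution one_le_two ENNReal.ofNat_ne_top
    (K := fun x : ℝ => ENNReal.ofReal (Real.exp (-|k.re| * |x|)))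
    (v := (Ioi (0 : ℝ)).indicator g) (by fun_prop)
    (lintegral_exp_neg_mul_abs_ne_top (abs_pos.mpr hk)) hf
    ((memLp_indicator_iff_restrict measurableSet_Ioi).mpr hg) ?_
  filter_upwards [ae_restrict_mem measurableSet_Ioi] with x hx
  rw [← ofReal_norm, h x hx, ofReal_norm]
  refine (enorm_integral_le_lintegral_enorm _).trans
    ((lintegral_mono_ae ?_).trans (setLIntegral_le_lintegral (s x) _))
  filter_upwards [ae_restrict_mem (hs x)] with t ht
  rw [indicator_of_mem (hs_pos x ht), ← mul_assoc, enorm_mul, ← Complex.exp_add,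
    show k * x + -k * t = k * ((x - t : ℝ) : ℂ) by push_cast; ring, enorm_exp_mul_ofReal]
  gcongr ENNReal.ofReal (Real.exp ?_) * _
  exact hdecay x t ht

theorem memLp_duhamel_of_re_neg (hk : k.re < 0) (hgl : LocallyIntegrable g volume)
    (hg : MemLp g 2 (volume.restrict (Ioi (0 : ℝ)))) :
    MemLp (duhamel k g) 2 (volume.restrict (Ioi (0 : ℝ))) := by
  refine memLp_of_eq_integral_exp_mul hk.ne (continuous_duhamel hgl).aestronglyMeasurable hg
    (s := Ioc 0) (fun _ => measurableSet_Ioc) (fun x => Ioc_subset_Ioi_self) (fun x t ht => ?_)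
    fun x hx => ?_
  · rw [abs_of_neg hk, abs_of_nonneg (sub_nonneg.mpr ht.2), neg_neg]
  · rw [duhamel, intervalIntegral.integral_of_le hx.le, integral_const_mul]

theorem memLp_duhamel_of_re_pos (hk : 0 < k.re) (hgl : LocallyIntegrable g volume)
    (hg : MemLp g 2 (volume.restrict (Ioi (0 : ℝ))))
    (h0 : ∫ t in Ioi (0 : ℝ), Complex.exp (-k * t) * g t = 0) :
    MemLp (duhamel k g) 2 (volume.restrict (Ioi (0 : ℝ))) := by
  refine memLp_of_eq_integral_exp_mul hk.ne' (continuous_duhamel hgl).aestronglyMeasurable hg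
    (s := fun x => Ioi (max x 0)) (fun _ => measurableSet_Ioi)
    (fun x => Ioi_subset_Ioi (le_max_right x 0)) (fun x t ht => ?_) fun x hx => ?_
  · rw [abs_of_pos hk, abs_of_neg (sub_neg.mpr ((le_max_left x 0).trans_lt ht))]
    linarith
  · have hInt : IntegrableOn (fun t : ℝ => Complex.exp (-k * t) * g t) (Ioi 0) :=
      (memLp_exp (by simpa using hk)).integrable_mul hg
    have hsplit := intervalIntegral.integral_interval_add_Ioi hInt
      (hInt.mono_set (Ioi_subset_Ioi hx.le))
    rw [duhamel, eq_neg_of_add_eq_zero_left (hsplit.trans h0), mul_neg, norm_neg,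
      integral_const_mul, max_eq_left hx.le]

end Duhamel

theorem expVec_coeFn {c : ℂ} (hc : c.re < 0) :
    ∀ᵐ x ∂(volume.restrict (Ioi (0 : ℝ))), expVec c x = Complex.exp (c * x) := by
  rw [expVec, dif_pos (memLp_exp hc)]
  exact (memLp_exp hc).coeFn_toLp

theorem inner_expVec_left {c : ℂ} (hc : c.re < 0) (u : L2) :
    inner ℂ (expVec c) u = ∫ x in Ioi (0 : ℝ), Complex.exp (starRingEnd ℂ c * x) * u x := by
  rw [L2.inner_def]
  refine integral_congr_ae ?_
  filter_upwards [expVec_coeFn hc] with x hx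
  rw [RCLike.inner_apply, hx, ← Complex.exp_conj, map_mul, Complex.conj_ofReal, mul_comm]

theorem inner_expVec_expVec {c d : ℂ} (hc : c.re < 0) (hd : d.re < 0) :
    inner ℂ (expVec c) (expVec d) = -(starRingEnd ℂ c + d)⁻¹ := by
  have hre : (starRingEnd ℂ c + d).re < 0 := by
    rw [Complex.add_re, Complex.conj_re]
    exact add_neg hc hd
  have h := integral_exp_mul_complex_Ioi hre 0
  rw [Complex.ofReal_zero, mul_zero, Complex.exp_zero, neg_div, one_div] at h
  rw [inner_expVec_left hc, ← h]
  refine integral_congr_ae ?_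
  filter_upwards [expVec_coeFn hd] with x hx
  rw [hx, ← Complex.exp_add, add_mul]

theorem expVec_ne_zero {c : ℂ} (hc : c.re < 0) : expVec c ≠ 0 := by
  intro h
  have hinner := inner_expVec_expVec hc hc
  rw [h, inner_zero_left, eq_comm, neg_eq_zero, inv_eq_zero] at hinner
  have hre := congrArg Complex.re hinner
  rw [Complex.add_re, Complex.conj_re, Complex.zero_re] at hre
  linarith

theorem isRep_exp {c : ℂ} (hc : c.re < 0) :
    IsRep (fun x => Complex.exp (c * x)) (fun x => c * Complex.exp (c * x)) (expVec c)
      ((-c ^ 2) • expVec c) where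
  ae_eq := expVec_coeFn hc
  ac := ACLoc.of_contDiff (contDiff_exp_mul_ofReal c)
  hasDeriv x _ := hasDerivAt_exp_mul_ofReal c x
  ac_deriv := ACLoc.of_contDiff (contDiff_const.mul (contDiff_exp_mul_ofReal c))
  ae_hasDeriv := by
    filter_upwards [expVec_coeFn hc, Lp.coeFn_smul (-c ^ 2) (expVec c)] with x hx hsmul
    rw [hsmul, Pi.smul_apply, hx, smul_eq_mul]
    exact ((hasDerivAt_exp_mul_ofReal c x).const_mul c).congr_deriv (by ring)

theorem tendsto_mul_exp_nhdsGT_zero (c d : ℂ) :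
    Tendsto (fun x : ℝ => d * Complex.exp (c * x)) (𝓝[>] 0) (𝓝 d) := by
  have hcont : Continuous fun x : ℝ => d * Complex.exp (c * x) := by fun_prop
  simpa only [Complex.ofReal_zero, mul_zero, Complex.exp_zero, mul_one] using
    (hcont.tendsto 0).mono_left nhdsWithin_le_nhds

/-- The equation `-f'' + k² f = G` is solved by factoring `d²/dx² - k² = (d/dx + k)(d/dx - k)` and
inverting each factor by variation of constants; the hypothesis on `G` makes the solution of the
growing factor square integrable. -/
theorem exists_mem_minGraph_sub_smul_eq {k : ℂ} (hk : k.re < 0) {G : L2}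
    (hG : inner ℂ (expVec (starRingEnd ℂ k)) G = 0) :
    ∃ u : L2, (u, G - k ^ 2 • u) ∈ minGraph := by
  set g : ℝ → ℂ := (Ioi (0 : ℝ)).indicator G
  have hg : MemLp g 2 volume := (memLp_indicator_iff_restrict measurableSet_Ioi).mpr (Lp.memLp G)
  have hgl : LocallyIntegrable g volume := hg.locallyIntegrable one_le_two
  have hgG : ∀ x ∈ Ioi (0 : ℝ), g x = G x := fun x hx => indicator_of_mem hx _
  set h : ℝ → ℂ := fun x => -duhamel (-k) g x
  have hh : Continuous h := (continuous_duhamel hgl).neg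
  have hh_ac : ACLoc h := by simpa using! (acLoc_duhamel (k := -k) hgl).smul (-1)
  have hhL : MemLp h 2 (volume.restrict (Ioi (0 : ℝ))) := by
    refine (memLp_duhamel_of_re_pos (by simpa using hk) hgl (hg.restrict _) ?_).neg
    rw [inner_expVec_left (by simpa using hk), Complex.conj_conj] at hG
    rw [neg_neg, ← hG]
    exact setIntegral_congr_fun measurableSet_Ioi fun x hx => by simp only [hgG x hx]
  set f : ℝ → ℂ := duhamel k h
  have hfd : ∀ x, HasDerivAt f (k * f x + h x) x := hasDerivAt_duhamel hh
  have hfL : MemLp f 2 (volume.restrict (Ioi (0 : ℝ))) :=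
    memLp_duhamel_of_re_neg hk hh.locallyIntegrable hhL
  have hf_ac : ACLoc f := acLoc_duhamel hh.locallyIntegrable
  have hf : Continuous f := continuous_duhamel hh.locallyIntegrable
  refine ⟨hfL.toLp f, f, fun x => k * f x + h x, ⟨hfL.coeFn_toLp, hf_ac, fun x _ => hfd x,
    (hf_ac.smul k).add hh_ac, ?_⟩, ?_, ?_⟩
  · filter_upwards [ae_restrict_of_ae (ae_hasDerivAt_duhamel (k := -k) hgl),
      ae_restrict_mem measurableSet_Ioi, hfL.coeFn_toLp, Lp.coeFn_sub G (k ^ 2 • hfL.toLp f),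
      Lp.coeFn_smul (k ^ 2) (hfL.toLp f)] with x hd hx hfx hsub hsmul
    rw [hsub, Pi.sub_apply, hsmul, Pi.smul_apply, hfx, smul_eq_mul, ← hgG x hx]
    exact (((hfd x).const_mul k).add hd.neg).congr_deriv (by ring)
  · simpa [f, duhamel_zero] using (hf.tendsto 0).mono_left (nhdsWithin_le_nhds (s := Ioi 0))
  · have hcont : Continuous fun x => k * f x + h x := (continuous_const.mul hf).add hh
    simpa [f, h, duhamel_zero] using
      (hcont.tendsto 0).mono_left (nhdsWithin_le_nhds (s := Ioi 0))

theorem range_kMin_sub_smul {c : ℂ} (hc : c.re < 0) :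
    LinearMap.range (kMin.toFun - starRingEnd ℂ (-c ^ 2) • kMin.domain.subtype) =
      (Submodule.span ℂ {expVec c})ᗮ := by
  ext G
  rw [Submodule.mem_orthogonal_singleton_iff_inner_right]
  constructor
  · rintro ⟨u, rfl⟩
    obtain ⟨f, g, hfg, hf, hg⟩ := kMin_graph ▸ kMin.mem_graph u
    have hgreen := hfg.green_identity (isRep_exp hc) hf hg
      (by simpa using tendsto_mul_exp_nhdsGT_zero c 1) (tendsto_mul_exp_nhdsGT_zero c c)
    rw [zero_mul, zero_mul, sub_zero, inner_smul_left] at hgreen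
    simpa [inner_add_right, inner_sub_right, inner_smul_right] using hgreen
  · intro hG
    obtain ⟨u, hu⟩ := exists_mem_minGraph_sub_smul_eq (k := starRingEnd ℂ c) (by simpa using hc)
      (by rwa [Complex.conj_conj])
    obtain ⟨v, hv, hvu⟩ := kMin.mem_graph_iff.mp (kMin_graph ▸ hu)
    refine ⟨v, ?_⟩
    rw [LinearMap.sub_apply, LinearMap.smul_apply, LinearPMap.toFun_eq_coe, hvu,
      Submodule.subtype_apply, hv, map_neg, map_pow, neg_smul, sub_neg_eq_add, sub_add_cancel]

theorem defectSpace_kMin {c : ℂ} (hc : c.re < 0) :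
    defectSpace kMin (-c ^ 2) = Submodule.span ℂ {expVec c} := by
  rw [defectSpace, range_kMin_sub_smul hc, Submodule.orthogonal_orthogonal]

end HalfLine

/-! ### Self-adjoint extensions -/

section SelfAdjoint

variable {H : Type*} [NormedAddCommGroup H] [InnerProductSpace ℂ H] {T S A : H →ₗ.[ℂ] H}

theorem isFormalAdjoint_iff_forall_mem_graph :
    T.IsFormalAdjoint S ↔
      ∀ p ∈ T.graph, ∀ q ∈ S.graph, inner ℂ p.2 q.1 = inner ℂ p.1 q.2 := by
  refine ⟨fun h p hp q hq => ?_, fun h x y => h _ (T.mem_graph x) _ (S.mem_graph y)⟩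
  obtain ⟨x, hx, hTx⟩ := T.mem_graph_iff.mp hp
  obtain ⟨y, hy, hSy⟩ := S.mem_graph_iff.mp hq
  rw [← hx, ← hTx, ← hy, ← hSy]
  exact h x y

theorem dense_domain_of_isFormalAdjoint_self [CompleteSpace H] (hT : T.IsFormalAdjoint T)
    (hsurj : ∀ y, ∃ x : T.domain, T x + Complex.I • (x : H) = y) :
    Dense (T.domain : Set H) := by
  rw [Submodule.dense_iff_topologicalClosure_eq_top, Submodule.topologicalClosure_eq_top_iff,
    Submodule.eq_bot_iff]
  intro y hy
  obtain ⟨x, rfl⟩ := hsurj y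
  have horth := (Submodule.mem_orthogonal _ _).mp hy x x.2
  have hreal : (inner ℂ (x : H) (T x)).im = 0 := by
    rw [← Complex.conj_eq_iff_im, inner_conj_symm]
    exact hT x x
  have him := congrArg Complex.im horth
  rw [inner_add_right, inner_smul_right, Complex.add_im, hreal, Complex.I_mul_im, zero_add,
    ← RCLike.re_to_complex, ← norm_sq_eq_re_inner, Complex.zero_im] at him
  have hx : x = 0 := by simpa using him
  rw [hx, LinearPMap.map_zero, ZeroMemClass.coe_zero, smul_zero, add_zero]

theorem isSelfAdjoint_of_isFormalAdjoint_self [CompleteSpace H] (hT : T.IsFormalAdjoint T)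
    (hadd : ∀ y, ∃ x : T.domain, T x + Complex.I • (x : H) = y)
    (hsub : ∀ y, ∃ x : T.domain, T x - Complex.I • (x : H) = y) : IsSelfAdjoint T := by
  have hdense := dense_domain_of_isFormalAdjoint_self hT hadd
  have hle := LinearPMap.IsFormalAdjoint.le_adjoint hdense hT
  rw [LinearPMap.isSelfAdjoint_def]
  refine (LinearPMap.eq_of_le_of_domain_eq hle (le_antisymm hle.1 fun y hy => ?_)).symm
  obtain ⟨x, hx⟩ := hadd (T.adjoint ⟨y, hy⟩ + Complex.I • y)
  suffices y - x = 0 by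
    rw [sub_eq_zero.mp this]
    exact x.2
  obtain ⟨z, hz⟩ := hsub (y - x)
  have hadj := LinearPMap.adjoint_isFormalAdjoint hdense ⟨y, hy⟩ z
  rw [← inner_self_eq_zero (𝕜 := ℂ)]
  nth_rewrite 2 [← hz]
  rw [eq_sub_of_add_eq hx.symm] at hadj
  simp only [inner_sub_left, inner_add_left, inner_sub_right, inner_smul_left, inner_smul_right,
    Complex.conj_I] at hadj ⊢
  linear_combination hT x z - hadj

theorem graph_domRestrict_sup_span_singleton (hTS : T ≤ S) {x y : H} (hxy : (x, y) ∈ S.graph) :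
    (S.domRestrict (T.domain ⊔ Submodule.span ℂ {x})).graph =
      T.graph ⊔ Submodule.span ℂ {(x, y)} := by
  have mem_iff {p : H × H} : p ∈ (S.domRestrict (T.domain ⊔ Submodule.span ℂ {x})).graph ↔
      p ∈ S.graph ∧ p.1 ∈ T.domain ⊔ Submodule.span ℂ {x} := by
    rw [LinearPMap.mem_graph_iff, LinearPMap.mem_graph_iff]
    constructor
    · rintro ⟨z, hz, hSz⟩
      exact ⟨⟨⟨z, z.2.2⟩, hz, hSz⟩, hz ▸ z.2.1⟩
    · rintro ⟨⟨z, hz, hSz⟩, hmem⟩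
      exact ⟨⟨z, hz ▸ hmem, z.2⟩, hz, hSz⟩
  refine le_antisymm (fun p hp => ?_) (sup_le (fun p hp => ?_) ?_)
  · obtain ⟨hpS, hp⟩ := mem_iff.mp hp
    obtain ⟨u, hu, z, hz, hsum⟩ := Submodule.mem_sup.mp hp
    obtain ⟨c, rfl⟩ := Submodule.mem_span_singleton.mp hz
    refine Submodule.mem_sup.mpr ⟨(u, T ⟨u, hu⟩), T.mem_graph ⟨u, hu⟩, c • (x, y),
      Submodule.smul_mem _ c (Submodule.mem_span_singleton_self _), Prod.ext hsum ?_⟩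
    exact S.mem_graph_snd_inj' (S.graph.add_mem (LinearPMap.le_graph_of_le hTS
      (T.mem_graph ⟨u, hu⟩)) (S.graph.smul_mem c hxy)) hpS hsum
  · exact mem_iff.mpr ⟨LinearPMap.le_graph_of_le hTS hp,
      Submodule.mem_sup_left (T.mem_domain_of_mem_graph hp)⟩
  · exact (Submodule.span_singleton_le_iff_mem _ _).mpr
      (mem_iff.mpr ⟨hxy, Submodule.mem_sup_right (Submodule.mem_span_singleton_self _)⟩)

theorem isFormalAdjoint_self_of_graph_eq_sup_span (hT : T.IsFormalAdjoint T) {x y : H}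
    (hTx : ∀ u : T.domain, inner ℂ (T u) x = inner ℂ (u : H) y) (hxy : inner ℂ y x = inner ℂ x y)
    (hA : A.graph = T.graph ⊔ Submodule.span ℂ {(x, y)}) : A.IsFormalAdjoint A := by
  have exists_eq {p : H × H} (hp : p ∈ A.graph) :
      ∃ (u : T.domain) (c : ℂ), ((u : H) + c • x, T u + c • y) = p := by
    obtain ⟨q, hq, r, hr, rfl⟩ := Submodule.mem_sup.mp (hA ▸ hp)
    obtain ⟨u, hu, hTu⟩ := T.mem_graph_iff.mp hq
    obtain ⟨c, rfl⟩ := Submodule.mem_span_singleton.mp hr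
    exact ⟨u, c, by rw [hu, hTu]; rfl⟩
  rw [isFormalAdjoint_iff_forall_mem_graph]
  intro p hp q hq
  obtain ⟨u, c, rfl⟩ := exists_eq hp
  obtain ⟨v, d, rfl⟩ := exists_eq hq
  have hxT : inner ℂ x (T v) = inner ℂ y (v : H) := by
    rw [← inner_conj_symm, hTx, inner_conj_symm]
  simp only [inner_add_left, inner_add_right, inner_smul_left, inner_smul_right, hT u v, hTx,
    hxT, hxy]

theorem exists_eq_add_smul_of_range_eq_orthogonal {p : H} (hp : ‖p‖ = 1) {L : T.domain →ₗ[ℂ] H}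
    (hL : LinearMap.range L = (Submodule.span ℂ {p})ᗮ) (y : H) :
    ∃ (u : T.domain) (c : ℂ), y = L u + c • p := by
  have hmem : y - inner ℂ p y • p ∈ LinearMap.range L := by
    rw [hL, Submodule.mem_orthogonal_singleton_iff_inner_right, inner_sub_right,
      inner_smul_right, inner_self_eq_norm_sq_to_K, hp]
    simp
  obtain ⟨u, hu⟩ := hmem
  exact ⟨u, inner ℂ p y, by rw [hu, sub_add_cancel]⟩

theorem inner_apply_of_range_sub_smul_eq_orthogonal {p : H} {w : ℂ}
    (hrange : LinearMap.range (T.toFun - starRingEnd ℂ w • T.domain.subtype) =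
      (Submodule.span ℂ {p})ᗮ) (u : T.domain) : inner ℂ (T u) p = w * inner ℂ (u : H) p := by
  have h := (hrange ▸ LinearMap.mem_range_self _ u :
    T u - starRingEnd ℂ w • (u : H) ∈ (Submodule.span ℂ {p})ᗮ)
  rwa [Submodule.mem_orthogonal_singleton_iff_inner_left, inner_sub_left, inner_smul_left,
    Complex.conj_conj, sub_eq_zero] at h

/-- Von Neumann's extension for the partial isometry `p ↦ m` between the defect spaces: on the new
vector `χ = m - p` the operators `A + i` and `A - i` take the values `-2i p` and `-2i m`. -/
theorem isSelfAdjoint_of_graph_eq_sup_span [CompleteSpace H] (hT : T.IsFormalAdjoint T) {p m : H}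
    (hp : ‖p‖ = 1) (hm : ‖m‖ = 1)
    (hrange_add : LinearMap.range (T.toFun - starRingEnd ℂ Complex.I • T.domain.subtype) =
      (Submodule.span ℂ {p})ᗮ)
    (hrange_sub : LinearMap.range (T.toFun - starRingEnd ℂ (-Complex.I) • T.domain.subtype) =
      (Submodule.span ℂ {m})ᗮ)
    (hA : A.graph = T.graph ⊔ Submodule.span ℂ {(m - p, -Complex.I • (m + p))}) :
    IsSelfAdjoint A := by
  have hmem (u : T.domain) (c : ℂ) :
      ((u : H) + c • (m - p), T u + c • (-Complex.I • (m + p))) ∈ A.graph :=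
    hA ▸ Submodule.add_mem_sup (T.mem_graph u)
      (Submodule.smul_mem _ c (Submodule.mem_span_singleton_self _))
  refine isSelfAdjoint_of_isFormalAdjoint_self
    (isFormalAdjoint_self_of_graph_eq_sup_span hT (fun u => ?_) ?_ hA) (fun y => ?_) fun y => ?_
  · rw [inner_sub_right, inner_apply_of_range_sub_smul_eq_orthogonal hrange_add,
      inner_apply_of_range_sub_smul_eq_orthogonal hrange_sub, inner_smul_right, inner_add_right]
    ring
  · simp only [inner_sub_left, inner_add_left, inner_sub_right, inner_add_right, inner_smul_left,
      inner_smul_right, inner_self_eq_norm_sq_to_K, hp, hm, map_neg, Complex.conj_I]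
    ring
  · obtain ⟨u, c, rfl⟩ := exists_eq_add_smul_of_range_eq_orthogonal hp hrange_add y
    obtain ⟨x, hx, hAx⟩ := A.mem_graph_iff.mp (hmem u (c * Complex.I / 2))
    refine ⟨x, ?_⟩
    rw [hx, hAx, LinearMap.sub_apply, LinearMap.smul_apply, LinearPMap.toFun_eq_coe,
      Submodule.subtype_apply, Complex.conj_I]
    match_scalars
    · ring
    · ring
    · linear_combination -c * Complex.I_sq
    · ring
  · obtain ⟨u, c, rfl⟩ := exists_eq_add_smul_of_range_eq_orthogonal hm hrange_sub y
    obtain ⟨x, hx, hAx⟩ := A.mem_graph_iff.mp (hmem u (c * Complex.I / 2))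
    refine ⟨x, ?_⟩
    rw [hx, hAx, LinearMap.sub_apply, LinearMap.smul_apply, LinearPMap.toFun_eq_coe,
      Submodule.subtype_apply, map_neg, Complex.conj_I]
    match_scalars
    · ring
    · linear_combination -c * Complex.I_sq
    · ring
    · ring

end SelfAdjoint

/-! ### The defect vectors of the minimal operator -/

namespace HalfLine

theorem kMin_isFormalAdjoint_self : kMin.IsFormalAdjoint kMin := by
  rw [isFormalAdjoint_iff_forall_mem_graph, kMin_graph]
  rintro p ⟨f, g, h, hf, hg⟩ q ⟨f', g', h', hf', hg'⟩
  have hgreen := h'.green_identity h hf' hg' hf hg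
  rw [zero_mul, sub_self, sub_eq_zero] at hgreen
  exact hgreen.symm

theorem csqrt_sq (z : ℂ) : csqrt z ^ 2 = z := by
  rw [csqrt, one_div]
  exact Complex.cpow_nat_inv_pow z two_ne_zero

theorem csqrt_re_nonneg (z : ℂ) : 0 ≤ (csqrt z).re := by
  rw [csqrt, one_div, Complex.cpow_inv_two_re]
  positivity

theorem csqrt_eq_of_sq_eq {z s : ℂ} (h : s ^ 2 = z) (hs : 0 < s.re) : csqrt z = s := by
  rcases sq_eq_sq_iff_eq_or_eq_neg.mp ((csqrt_sq z).trans h.symm) with heq | hneg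
  · exact heq
  · have hre := csqrt_re_nonneg z
    rw [hneg, Complex.neg_re] at hre
    linarith

theorem two_mul_re_mul_im_csqrt (w : ℂ) : 2 * ((csqrt w).re * (csqrt w).im) = w.im := by
  have h := congrArg Complex.im (csqrt_sq w)
  rw [sq, Complex.mul_im] at h
  linarith

theorem csqrt_re_pos {w : ℂ} (hw : 0 < w.im) : 0 < (csqrt w).re := by
  have h := two_mul_re_mul_im_csqrt w
  refine (csqrt_re_nonneg w).lt_of_ne fun h0 => ?_
  rw [← h0] at h
  linarith

theorem csqrt_im_pos {w : ℂ} (hw : 0 < w.im) : 0 < (csqrt w).im := by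
  have h := two_mul_re_mul_im_csqrt w
  exact pos_of_mul_pos_right (a := (csqrt w).re) (by linarith) (csqrt_re_nonneg w)

/-- The primitive eighth root of unity `e^{iπ/4}`, the principal square root of `i`. -/
def eighthRoot : ℂ := (1 + Complex.I) / (Real.sqrt 2 : ℝ)

theorem ofReal_sqrt_two_sq : ((Real.sqrt 2 : ℝ) : ℂ) ^ 2 = 2 := by
  rw [← Complex.ofReal_pow, Real.sq_sqrt zero_le_two, Complex.ofReal_ofNat]

theorem eighthRoot_sq : eighthRoot ^ 2 = Complex.I := by
  rw [eighthRoot, div_pow, ofReal_sqrt_two_sq]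
  linear_combination (1 / 2) * Complex.I_sq

theorem eighthRoot_re : eighthRoot.re = (Real.sqrt 2)⁻¹ := by
  simp [eighthRoot, Complex.div_ofReal_re]

theorem eighthRoot_im : eighthRoot.im = (Real.sqrt 2)⁻¹ := by
  simp [eighthRoot, Complex.div_ofReal_im]

theorem conj_eighthRoot : starRingEnd ℂ eighthRoot = (1 - Complex.I) / (Real.sqrt 2 : ℝ) := by
  simp [eighthRoot, sub_eq_add_neg]

theorem conj_eighthRoot_sq : starRingEnd ℂ eighthRoot ^ 2 = -Complex.I := by
  rw [← map_pow, eighthRoot_sq, Complex.conj_I]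

theorem I_mul_conj_eighthRoot : Complex.I * starRingEnd ℂ eighthRoot = eighthRoot := by
  rw [conj_eighthRoot, eighthRoot]
  linear_combination -(Complex.I_sq / (Real.sqrt 2 : ℝ))

theorem I_mul_eighthRoot : Complex.I * eighthRoot = -starRingEnd ℂ eighthRoot := by
  linear_combination -Complex.I * I_mul_conj_eighthRoot +
    starRingEnd ℂ eighthRoot * Complex.I_sq

theorem eighthRoot_re_pos : 0 < eighthRoot.re := by
  rw [eighthRoot_re]
  positivity

theorem csqrt_I : csqrt Complex.I = eighthRoot :=
  csqrt_eq_of_sq_eq eighthRoot_sq eighthRoot_re_pos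

theorem csqrt_neg_I : csqrt (-Complex.I) = starRingEnd ℂ eighthRoot :=
  csqrt_eq_of_sq_eq conj_eighthRoot_sq eighthRoot_re_pos

theorem phiPlus_eq : phiPlus = (((2 : ℝ) ^ (1 / 4 : ℝ) : ℝ) : ℂ) •
    expVec (-starRingEnd ℂ eighthRoot) := by
  rw [phiPlus, csqrt_I, I_mul_eighthRoot]

theorem phiMinus_eq :
    phiMinus = (((2 : ℝ) ^ (1 / 4 : ℝ) : ℝ) : ℂ) • expVec (-eighthRoot) := by
  rw [phiMinus, csqrt_neg_I, I_mul_conj_eighthRoot]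

theorem neg_eighthRoot_re_neg : (-eighthRoot).re < 0 :=
  neg_lt_zero.mpr eighthRoot_re_pos

theorem neg_conj_eighthRoot_re_neg : (-starRingEnd ℂ eighthRoot).re < 0 :=
  neg_eighthRoot_re_neg

theorem two_rpow_fourth_ne_zero : (((2 : ℝ) ^ (1 / 4 : ℝ) : ℝ) : ℂ) ≠ 0 :=
  Complex.ofReal_ne_zero.mpr (Real.rpow_pos_of_pos zero_lt_two _).ne'

theorem norm_expVec_sq {c : ℂ} (hc : c.re < 0) : ‖expVec c‖ ^ 2 = (-(2 * c.re))⁻¹ := by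
  have h : (‖expVec c‖ : ℂ) ^ 2 = -(starRingEnd ℂ c + c)⁻¹ :=
    (inner_self_eq_norm_sq_to_K _).symm.trans (inner_expVec_expVec hc hc)
  rw [add_comm, Complex.add_conj, ← inv_neg] at h
  exact_mod_cast h

theorem norm_two_rpow_fourth_smul_expVec {c : ℂ} (hc : c.re = -(Real.sqrt 2)⁻¹) :
    ‖(((2 : ℝ) ^ (1 / 4 : ℝ) : ℝ) : ℂ) • expVec c‖ = 1 := by
  have hsqrt : ((2 : ℝ) ^ (1 / 4 : ℝ)) ^ 2 = Real.sqrt 2 := by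
    rw [← Real.rpow_natCast, ← Real.rpow_mul zero_le_two, Real.sqrt_eq_rpow]
    norm_num
  have hc0 : c.re < 0 := by
    rw [hc, neg_lt_zero]
    positivity
  rw [← sq_eq_sq₀ (norm_nonneg _) zero_le_one, norm_smul, mul_pow, norm_expVec_sq hc0,
    Complex.norm_real, Real.norm_eq_abs, sq_abs, hsqrt, hc]
  field_simp
  exact Real.sq_sqrt zero_le_two

theorem norm_phiPlus : ‖phiPlus‖ = 1 := by
  rw [phiPlus_eq]
  exact norm_two_rpow_fourth_smul_expVec (by rw [Complex.neg_re, Complex.conj_re, eighthRoot_re])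

theorem norm_phiMinus : ‖phiMinus‖ = 1 := by
  rw [phiMinus_eq]
  exact norm_two_rpow_fourth_smul_expVec (by rw [Complex.neg_re, eighthRoot_re])

theorem span_phiPlus :
    Submodule.span ℂ {phiPlus} = Submodule.span ℂ {expVec (-starRingEnd ℂ eighthRoot)} := by
  rw [phiPlus_eq, Submodule.span_singleton_smul_eq two_rpow_fourth_ne_zero.isUnit]

theorem span_phiMinus : Submodule.span ℂ {phiMinus} = Submodule.span ℂ {expVec (-eighthRoot)} := by
  rw [phiMinus_eq, Submodule.span_singleton_smul_eq two_rpow_fourth_ne_zero.isUnit]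

theorem neg_neg_conj_eighthRoot_sq : -(-starRingEnd ℂ eighthRoot) ^ 2 = Complex.I := by
  rw [neg_sq, conj_eighthRoot_sq, neg_neg]

theorem neg_neg_eighthRoot_sq : -(-eighthRoot) ^ 2 = -Complex.I := by
  rw [neg_sq, eighthRoot_sq]

theorem I_mul_csqrt_re_neg {w : ℂ} (hw : 0 < w.im) : (Complex.I * csqrt w).re < 0 := by
  rw [Complex.I_mul_re, neg_lt_zero]
  exact csqrt_im_pos hw

theorem isDefectBasis_kMin : IsDefectBasis kMin psi phiPlus phiMinus where
  ne_zero w hw := expVec_ne_zero (I_mul_csqrt_re_neg hw)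
  span_eq w hw := by
    simpa only [mul_pow, Complex.I_sq, csqrt_sq, neg_one_mul, neg_neg] using!
      defectSpace_kMin (I_mul_csqrt_re_neg hw)
  norm_pos := norm_phiPlus
  span_pos := by
    rw [span_phiPlus, ← defectSpace_kMin neg_conj_eighthRoot_re_neg, neg_neg_conj_eighthRoot_sq]
  norm_neg := norm_phiMinus
  span_neg := by
    rw [span_phiMinus, ← defectSpace_kMin neg_eighthRoot_re_neg, neg_neg_eighthRoot_sq]

theorem kMin_le_kMax : kMin ≤ kMax := by
  rw [← LinearPMap.le_graph_iff, kMin_graph, kMax_graph]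
  exact minGraph_le_maxGraph

theorem kMin_le_kExt (α : ℂ) : kMin ≤ kExt α :=
  ⟨le_inf le_sup_left kMin_le_kMax.1, fun _ _ h => kMin_le_kMax.2 h⟩

theorem expVec_mem_maxGraph {c : ℂ} (hc : c.re < 0) :
    (expVec c, -c ^ 2 • expVec c) ∈ maxGraph :=
  ⟨_, _, isRep_exp hc⟩

theorem phiPlus_mem_maxGraph : (phiPlus, Complex.I • phiPlus) ∈ maxGraph := by
  have h := maxGraph.smul_mem (((2 : ℝ) ^ (1 / 4 : ℝ) : ℝ) : ℂ)
    (expVec_mem_maxGraph neg_conj_eighthRoot_re_neg)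
  rwa [neg_neg_conj_eighthRoot_sq, Prod.smul_mk, smul_comm _ Complex.I, ← phiPlus_eq] at h

theorem phiMinus_mem_maxGraph : (phiMinus, -Complex.I • phiMinus) ∈ maxGraph := by
  have h := maxGraph.smul_mem (((2 : ℝ) ^ (1 / 4 : ℝ) : ℝ) : ℂ)
    (expVec_mem_maxGraph neg_eighthRoot_re_neg)
  rwa [neg_neg_eighthRoot_sq, Prod.smul_mk, smul_comm _ (-Complex.I), ← phiMinus_eq] at h

theorem graph_kExt (α : ℂ) : (kExt α).graph = kMin.graph ⊔
    Submodule.span ℂ {(α • phiMinus - phiPlus, -Complex.I • (α • phiMinus + phiPlus))} := by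
  refine graph_domRestrict_sup_span_singleton kMin_le_kMax ?_
  rw [kMax_graph]
  convert! maxGraph.sub_mem (maxGraph.smul_mem α phiMinus_mem_maxGraph) phiPlus_mem_maxGraph
    using 1
  exact Prod.ext rfl (by simp only [Prod.snd_sub, Prod.smul_snd]; module)

theorem isSelfAdjoint_kExt {α : ℂ} (hα : ‖α‖ = 1) : IsSelfAdjoint (kExt α) := by
  have hα0 : α ≠ 0 := norm_ne_zero_iff.mp (hα ▸ one_ne_zero)
  refine isSelfAdjoint_of_graph_eq_sup_span kMin_isFormalAdjoint_self norm_phiPlus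
    (by rw [norm_smul, hα, norm_phiMinus, mul_one]) ?_ ?_ (graph_kExt α)
  · rw [span_phiPlus, ← range_kMin_sub_smul neg_conj_eighthRoot_re_neg,
      neg_neg_conj_eighthRoot_sq]
  · rw [Submodule.span_singleton_smul_eq hα0.isUnit, span_phiMinus,
      ← range_kMin_sub_smul neg_eighthRoot_re_neg, neg_neg_eighthRoot_sq]

end HalfLine

/-! ### Poisson integrals on the unit circle -/

local notation "𝕋" => Metric.sphere (0 : ℂ) 1

theorem coe_cayleyReal (s : ℝ) : (cayleyReal s : ℂ) = (s - Complex.I) / (s + Complex.I) := rfl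

theorem continuous_cayleyReal : Continuous cayleyReal :=
  Continuous.subtype_mk ((Complex.continuous_ofReal.sub continuous_const).div
    (Complex.continuous_ofReal.add continuous_const) ofReal_add_I_ne_zero) _

theorem cayleyReal_ne_one (s : ℝ) : (cayleyReal s : ℂ) ≠ 1 := by
  rw [coe_cayleyReal, Ne, div_eq_one_iff_eq (ofReal_add_I_ne_zero s)]
  intro h
  have him := congrArg Complex.im h
  norm_num at him

theorem cayleyInv_cayleyReal (s : ℝ) : cayleyInv (cayleyReal s) = s := by
  have hs := ofReal_add_I_ne_zero s
  rw [cayleyInv, div_eq_iff (sub_ne_zero.mpr (cayleyReal_ne_one s).symm), coe_cayleyReal]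
  field_simp
  ring

theorem cayleyReal_injective : Function.Injective cayleyReal := fun s t h =>
  Complex.ofReal_injective (by rw [← cayleyInv_cayleyReal s, h, cayleyInv_cayleyReal t])

theorem measurableEmbedding_cayleyReal : MeasurableEmbedding cayleyReal :=
  continuous_cayleyReal.measurableEmbedding cayleyReal_injective

/-- The normalized arc length measure on the unit circle. It is defined as the image of the
standard Cauchy distribution under the Cayley transform, so that densities on the line and on the
circle are directly comparable. -/
def arcMeasure : Measure 𝕋 :=
  (ProbabilityTheory.cauchyMeasure 0 1).map cayleyReal

instance : IsProbabilityMeasure arcMeasure :=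
  Measure.isProbabilityMeasure_map continuous_cayleyReal.aemeasurable

theorem circleMap_pi_add_two_mul_arctan (s : ℝ) :
    circleMap 0 1 (Real.pi + 2 * Real.arctan s) = (cayleyReal s : ℂ) := by
  have hs : (1 + (s : ℂ) ^ 2) ≠ 0 := by exact_mod_cast (by positivity : (1 + s ^ 2 : ℝ) ≠ 0)
  have hcos : Real.cos (2 * Real.arctan s) = (1 - s ^ 2) / (1 + s ^ 2) := by
    rw [Real.cos_two_mul, Real.cos_sq_arctan]
    field_simp
    ring
  have hsin : Real.sin (2 * Real.arctan s) = 2 * s / (1 + s ^ 2) := by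
    rw [Real.sin_two_mul, Real.sin_arctan, Real.cos_arctan]
    field_simp
    rw [Real.sq_sqrt (by positivity)]
  rw [coe_cayleyReal, eq_div_iff (ofReal_add_I_ne_zero s), circleMap, Complex.ofReal_one, one_mul,
    zero_add, Complex.exp_mul_I, ← Complex.ofReal_cos, ← Complex.ofReal_sin, add_comm Real.pi,
    Real.cos_add_pi, Real.sin_add_pi, hcos, hsin]
  push_cast
  field_simp
  linear_combination (-2 * (s : ℂ)) * Complex.I_sq

theorem image_univ_pi_add_two_mul_arctan :
    (fun s : ℝ => Real.pi + 2 * Real.arctan s) '' univ = Ioo 0 (2 * Real.pi) := by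
  ext θ
  constructor
  · rintro ⟨s, -, rfl⟩
    have hlower := Real.neg_pi_div_two_lt_arctan s
    have hupper := Real.arctan_lt_pi_div_two s
    constructor <;> linarith
  · rintro ⟨hlower, hupper⟩
    refine ⟨Real.tan ((θ - Real.pi) / 2), mem_univ _, ?_⟩
    dsimp only
    rw [Real.arctan_tan (by linarith) (by linarith)]
    ring

theorem integral_cauchyMeasure {E : Type*} [NormedAddCommGroup E] [NormedSpace ℝ E]
    (x₀ : ℝ) {γ : NNReal} (hγ : γ ≠ 0) (F : ℝ → E) :
    ∫ s, F s ∂ProbabilityTheory.cauchyMeasure x₀ γ =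
      ∫ s, ProbabilityTheory.cauchyPDFReal x₀ γ s • F s := by
  rw [ProbabilityTheory.cauchyMeasure_of_scale_ne_zero x₀ hγ,
    integral_withDensity_eq_integral_toReal_smul (ProbabilityTheory.measurable_cauchyPDF x₀ γ)
      (Eventually.of_forall fun _ => ENNReal.ofReal_lt_top)]
  simp only [ProbabilityTheory.cauchyPDF_def,
    ENNReal.toReal_ofReal (ProbabilityTheory.cauchyPDF_pos x₀ hγ _).le]

theorem integral_arcMeasure {E : Type*} [NormedAddCommGroup E] [NormedSpace ℝ E] (F : 𝕋 → E) :
    ∫ t, F t ∂arcMeasure = ∫ s, ProbabilityTheory.cauchyPDFReal 0 1 s • F (cayleyReal s) := by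
  rw [arcMeasure, measurableEmbedding_cayleyReal.integral_map,
    integral_cauchyMeasure 0 one_ne_zero]

theorem circleAverage_eq_integral_arcMeasure {E : Type*} [NormedAddCommGroup E] [NormedSpace ℝ E]
    (F : ℂ → E) : Real.circleAverage F 0 1 = ∫ t : 𝕋, F t ∂arcMeasure := by
  have hderiv : ∀ s ∈ (univ : Set ℝ), HasDerivWithinAt
      (fun s : ℝ => Real.pi + 2 * Real.arctan s) (2 * (1 / (1 + s ^ 2))) univ s := fun s _ =>
    (((Real.hasDerivAt_arctan s).const_mul 2).const_add _).hasDerivWithinAt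
  have hinj : InjOn (fun s : ℝ => Real.pi + 2 * Real.arctan s) univ := fun s _ t _ h =>
    Real.arctan_injective (by simpa using h)
  rw [Real.circleAverage_def, intervalIntegral.integral_of_le (by positivity),
    integral_Ioc_eq_integral_Ioo, ← image_univ_pi_add_two_mul_arctan,
    integral_image_eq_integral_abs_deriv_smul MeasurableSet.univ hderiv hinj, setIntegral_univ,
    integral_arcMeasure, ← integral_smul]
  refine integral_congr_ae (Eventually.of_forall fun s => ?_)
  dsimp only
  rw [circleMap_pi_add_two_mul_arctan, smul_smul, ProbabilityTheory.cauchyPDFReal_def,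
    abs_of_pos (by positivity)]
  congr 1
  push_cast
  field_simp
  ring

theorem integrable_of_continuous_of_compactSpace {X E : Type*} [TopologicalSpace X]
    [MeasurableSpace X] [OpensMeasurableSpace X] [CompactSpace X] [NormedAddCommGroup E]
    {f : X → E} (hf : Continuous f) (μ : Measure X) [IsFiniteMeasureOnCompacts μ] :
    Integrable f μ :=
  hf.integrable_of_hasCompactSupport (HasCompactSupport.of_compactSpace f)

theorem norm_ofReal_mul_coe_sphere (r : ℝ) (t : 𝕋) : ‖(r * t : ℂ)‖ = |r| := by
  rw [norm_mul, norm_eq_of_mem_sphere, mul_one, Complex.norm_real, Real.norm_eq_abs]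

theorem coe_sphere_sub_ne_zero (t : 𝕋) {z : ℂ} (hz : ‖z‖ < 1) : (t : ℂ) - z ≠ 0 := by
  rw [sub_ne_zero]
  rintro rfl
  exact hz.ne (norm_eq_of_mem_sphere t)

theorem poissonKernel_zero_coe (z : ℂ) (t : 𝕋) :
    poissonKernel 0 z t = (1 - ‖z‖ ^ 2) / ‖(t : ℂ) - z‖ ^ 2 := by
  rw [poissonKernel_def, sub_zero, sub_zero, norm_eq_of_mem_sphere, one_pow]

theorem poissonKernel_zero_coe_nonneg {z : ℂ} (hz : ‖z‖ < 1) (t : 𝕋) :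
    0 ≤ poissonKernel 0 z t := by
  rw [poissonKernel_zero_coe]
  exact div_nonneg (sub_nonneg.mpr (pow_le_one₀ (norm_nonneg z) hz.le)) (by positivity)

theorem continuousOn_poissonKernel_zero :
    ContinuousOn (fun p : ℂ × 𝕋 => poissonKernel 0 p.1 p.2) {p | ‖p.1‖ < 1} := by
  simp only [poissonKernel_zero_coe]
  exact ContinuousOn.div (by fun_prop) (by fun_prop) fun p hp =>
    pow_ne_zero _ (norm_ne_zero_iff.mpr (coe_sphere_sub_ne_zero p.2 hp))

theorem continuous_poissonKernel_zero {z : ℂ} (hz : ‖z‖ < 1) :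
    Continuous fun t : 𝕋 => poissonKernel 0 z t :=
  continuousOn_poissonKernel_zero.comp_continuous (f := fun t : 𝕋 => (z, t)) (by fun_prop)
    fun _ => hz

theorem continuous_poissonKernel_zero_ofReal_mul {r : ℝ} (hr : |r| < 1) :
    Continuous fun p : 𝕋 × 𝕋 => poissonKernel 0 (r * p.1) p.2 :=
  continuousOn_poissonKernel_zero.comp_continuous (f := fun p : 𝕋 × 𝕋 => ((r * p.1 : ℂ), p.2))
    (by fun_prop) fun p => by rwa [mem_ofPred_eq, norm_ofReal_mul_coe_sphere]

theorem norm_coe_sphere_sub_ofReal_mul_sq (r : ℝ) (t t' : 𝕋) :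
    ‖(t' : ℂ) - r * t‖ ^ 2 = 1 + r ^ 2 - 2 * r * inner ℝ (t : ℂ) (t' : ℂ) := by
  rw [norm_sub_sq_real, norm_ofReal_mul_coe_sphere, norm_eq_of_mem_sphere, real_inner_comm,
    ← Complex.real_smul, real_inner_smul_left, sq_abs]
  ring

theorem poissonKernel_zero_ofReal_mul_comm (r : ℝ) (t t' : 𝕋) :
    poissonKernel 0 (r * t) t' = poissonKernel 0 (r * t') t := by
  simp only [poissonKernel_zero_coe, norm_ofReal_mul_coe_sphere, norm_coe_sphere_sub_ofReal_mul_sq,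
    real_inner_comm]

theorem integral_poissonKernel_mul_re {f : ℂ → ℂ} (hf : DiffContOnCl ℂ f (Metric.ball 0 1))
    {z : ℂ} (hz : ‖z‖ < 1) :
    ∫ t : 𝕋, poissonKernel 0 z t * (f t).re ∂arcMeasure = (f z).re := by
  have hcont : Continuous fun t : 𝕋 => f t := by
    have hclosed := hf.2
    rw [closure_ball _ one_ne_zero] at hclosed
    exact hclosed.comp_continuous continuous_subtype_val fun t =>
      Metric.sphere_subset_closedBall t.2
  have hre := Complex.reCLM.integral_comp_comm (integrable_of_continuous_of_compactSpace
    ((continuous_poissonKernel_zero hz).smul hcont) arcMeasure)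
  have hpoisson := hf.circleAverage_poissonKernel_smul (w := z) (by simpa using hz)
  rw [circleAverage_eq_integral_arcMeasure] at hpoisson
  simp only [Complex.reCLM_apply, Pi.smul_apply', Complex.smul_re, smul_eq_mul] at hre hpoisson
  rw [hre, hpoisson]

theorem integral_poissonKernel_zero {z : ℂ} (hz : ‖z‖ < 1) :
    ∫ t : 𝕋, poissonKernel 0 z t ∂arcMeasure = 1 := by
  simpa using integral_poissonKernel_mul_re (f := fun _ => 1) diffContOnCl_const hz

theorem integral_poissonKernel_mul_norm_sub_sq {r : ℝ} (hr : |r| < 1) (t : 𝕋) :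
    ∫ t' : 𝕋, poissonKernel 0 (r * t) t' * ‖(t' : ℂ) - t‖ ^ 2 ∂arcMeasure = 2 - 2 * r := by
  have hdiff : DiffContOnCl ℂ (fun z : ℂ => (2 : ℝ) * (1 - starRingEnd ℂ (t : ℂ) * z))
      (Metric.ball 0 1) :=
    Differentiable.diffContOnCl (by fun_prop)
  convert! integral_poissonKernel_mul_re hdiff (z := r * t)
    (by rwa [norm_ofReal_mul_coe_sphere]) using 1
  · refine integral_congr_ae (Eventually.of_forall fun t' => ?_)
    have hnorm := norm_coe_sphere_sub_ofReal_mul_sq 1 t t'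
    rw [Complex.ofReal_one, one_mul, Complex.inner, mul_comm (t' : ℂ)] at hnorm
    dsimp only
    rw [hnorm, Complex.re_ofReal_mul, Complex.sub_re, Complex.one_re]
    ring
  · rw [mul_left_comm (starRingEnd ℂ _), Complex.conj_mul', norm_eq_of_mem_sphere,
      Complex.re_ofReal_mul]
    simp [mul_sub]

theorem exists_abs_sub_le_add_mul_dist_sq {X : Type*} [PseudoMetricSpace X] [CompactSpace X]
    {f : X → ℝ} (hf : Continuous f) {ε : ℝ} (hε : 0 < ε) :
    ∃ C : ℝ, ∀ x y, |f y - f x| ≤ ε + C * dist y x ^ 2 := by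
  obtain ⟨M, hM⟩ := isCompact_univ.exists_bound_of_continuousOn hf.continuousOn
  obtain ⟨δ, hδ, hclose⟩ := Metric.uniformContinuous_iff.mp
    (CompactSpace.uniformContinuous_of_continuous hf) ε hε
  refine ⟨2 * M / δ ^ 2, fun x y => ?_⟩
  have hM0 : 0 ≤ M := (norm_nonneg _).trans (hM x (mem_univ x))
  rcases lt_or_ge (dist y x) δ with hlt | hge
  · exact (hclose hlt).le.trans (le_add_of_nonneg_right (by positivity))
  · calc |f y - f x| ≤ |f y| + |f x| := abs_sub _ _
      _ ≤ 2 * M := by linarith [hM x (mem_univ x), hM y (mem_univ y), Real.norm_eq_abs (f x),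
          Real.norm_eq_abs (f y)]
      _ ≤ 2 * M / δ ^ 2 * dist y x ^ 2 := by
          rw [div_mul_eq_mul_div, le_div_iff₀ (by positivity)]
          gcongr
      _ ≤ ε + 2 * M / δ ^ 2 * dist y x ^ 2 := le_add_of_nonneg_left hε.le

theorem abs_integral_poissonKernel_mul_sub_le {f : 𝕋 → ℝ} (hf : Continuous f) {ε C : ℝ}
    (hC : ∀ t t', |f t' - f t| ≤ ε + C * dist t' t ^ 2) {r : ℝ} (hr : |r| < 1) (t : 𝕋) :
    |(∫ t' : 𝕋, poissonKernel 0 (r * t) t' * f t' ∂arcMeasure) - f t| ≤ ε + C * (2 - 2 * r) := by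
  have hz : ‖(r * t : ℂ)‖ < 1 := by rwa [norm_ofReal_mul_coe_sphere]
  have hP := continuous_poissonKernel_zero hz
  have hInt : ∀ {g : 𝕋 → ℝ}, Continuous g →
      Integrable (fun t' : 𝕋 => poissonKernel 0 (r * t) t' * g t') arcMeasure := fun hg =>
    integrable_of_continuous_of_compactSpace (hP.mul hg) _
  have hintP := integrable_of_continuous_of_compactSpace hP arcMeasure
  have hdist := hInt (g := fun t' => ‖(t' : ℂ) - t‖ ^ 2) (by fun_prop)
  have hleft : (∫ t' : 𝕋, poissonKernel 0 (r * t) t' * f t' ∂arcMeasure) - f t =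
      ∫ t' : 𝕋, poissonKernel 0 (r * t) t' * (f t' - f t) ∂arcMeasure := by
    simp only [mul_sub]
    rw [integral_sub (hInt hf) (hintP.mul_const _), integral_mul_const,
      integral_poissonKernel_zero hz, one_mul]
  have hright : ε + C * (2 - 2 * r) = ∫ t' : 𝕋, (ε * poissonKernel 0 (r * t) t' +
      C * (poissonKernel 0 (r * t) t' * ‖(t' : ℂ) - t‖ ^ 2)) ∂arcMeasure := by
    rw [integral_add (hintP.const_mul _) (hdist.const_mul _), integral_const_mul,
      integral_const_mul, integral_poissonKernel_zero hz,
      integral_poissonKernel_mul_norm_sub_sq hr, mul_one]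
  rw [hleft, hright, ← Real.norm_eq_abs]
  refine norm_integral_le_of_norm_le ((hintP.const_mul _).add (hdist.const_mul _))
    (Eventually.of_forall fun t' => ?_)
  have hle := mul_le_mul_of_nonneg_left (hC t t') (poissonKernel_zero_coe_nonneg hz t')
  rw [Subtype.dist_eq, dist_eq_norm] at hle
  rw [norm_mul, Real.norm_of_nonneg (poissonKernel_zero_coe_nonneg hz t'), Real.norm_eq_abs]
  linarith

theorem eventually_abs_lt_one_nhdsLT : ∀ᶠ r : ℝ in 𝓝[<] 1, |r| < 1 := by
  filter_upwards [Ioo_mem_nhdsLT (neg_lt_self one_pos)] with r hr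
  exact abs_lt.mpr hr

theorem tendstoUniformly_integral_poissonKernel_mul {f : 𝕋 → ℝ} (hf : Continuous f) :
    TendstoUniformly (fun (r : ℝ) (t : 𝕋) =>
      ∫ t' : 𝕋, poissonKernel 0 (r * t) t' * f t' ∂arcMeasure) f (𝓝[<] 1) := by
  rw [Metric.tendstoUniformly_iff]
  intro ε hε
  obtain ⟨C, hC⟩ := exists_abs_sub_le_add_mul_dist_sq hf (half_pos hε)
  have hlim : Tendsto (fun r : ℝ => ε / 2 + C * (2 - 2 * r)) (𝓝[<] 1) (𝓝 (ε / 2)) := by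
    have hcont : Continuous fun r : ℝ => ε / 2 + C * (2 - 2 * r) := by fun_prop
    simpa using (hcont.tendsto 1).mono_left (nhdsWithin_le_nhds (s := Iio 1))
  filter_upwards [hlim.eventually_lt_const (half_lt_self hε),
    eventually_abs_lt_one_nhdsLT] with r hr hr1 t
  rw [dist_comm, Real.dist_eq]
  exact (abs_integral_poissonKernel_mul_sub_le hf hC hr1 t).trans_lt hr

/-- The Poisson integral of a measure on the unit circle, a function on the unit disk. -/
def poissonIntegral (ν : Measure 𝕋) (z : ℂ) : ℝ :=
  ∫ t : 𝕋, poissonKernel 0 z t ∂ν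

theorem integral_mul_poissonIntegral_ofReal_mul (ν : Measure 𝕋) [IsFiniteMeasure ν] {f : 𝕋 → ℝ}
    (hf : Continuous f) {r : ℝ} (hr : |r| < 1) :
    ∫ t, f t * poissonIntegral ν (r * t) ∂arcMeasure =
      ∫ t, ∫ t' : 𝕋, poissonKernel 0 (r * t) t' * f t' ∂arcMeasure ∂ν := by
  simp only [poissonIntegral, ← integral_const_mul]
  rw [integral_integral_swap (integrable_of_continuous_of_compactSpace
    ((hf.comp continuous_fst).mul (continuous_poissonKernel_zero_ofReal_mul hr)) _)]
  simp only [poissonKernel_zero_ofReal_mul_comm r _ _, mul_comm (f _)]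

theorem tendsto_integral_mul_poissonIntegral (ν : Measure 𝕋) [IsFiniteMeasure ν] {f : 𝕋 → ℝ}
    (hf : Continuous f) :
    Tendsto (fun r : ℝ => ∫ t, f t * poissonIntegral ν (r * t) ∂arcMeasure) (𝓝[<] 1)
      (𝓝 (∫ t, f t ∂ν)) := by
  have hunif := tendstoUniformly_integral_poissonKernel_mul hf
  refine Tendsto.congr' (eventually_abs_lt_one_nhdsLT.mono fun r hr =>
    (integral_mul_poissonIntegral_ofReal_mul ν hf hr).symm) ?_
  refine tendsto_integral_filter_of_dominated_convergence (fun t => 1 + |f t|) ?_ ?_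
    ((integrable_const 1).add (integrable_of_continuous_of_compactSpace hf.abs ν))
    (Eventually.of_forall fun t => hunif.tendsto_at t)
  · filter_upwards [eventually_abs_lt_one_nhdsLT] with r hr
    have hcont := continuous_parametric_integral_of_continuous (μ := arcMeasure)
      (f := fun t t' : 𝕋 => poissonKernel 0 (r * t) t' * f t')
      ((continuous_poissonKernel_zero_ofReal_mul hr).mul (hf.comp continuous_snd)) isCompact_univ
    simp only [setIntegral_univ] at hcont
    exact hcont.aestronglyMeasurable
  · filter_upwards [Metric.tendstoUniformly_iff.mp hunif 1 one_pos] with r hr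
    refine Eventually.of_forall fun t => ?_
    rw [Real.norm_eq_abs]
    have hdist := hr t
    rw [dist_comm, Real.dist_eq] at hdist
    linarith [abs_sub_abs_le_abs_sub
      (∫ t' : 𝕋, poissonKernel 0 (r * t) t' * f t' ∂arcMeasure) (f t)]

theorem eq_of_poissonIntegral_eq {ν ν' : Measure 𝕋} [IsFiniteMeasure ν] [IsFiniteMeasure ν']
    (h : ∀ z : ℂ, ‖z‖ < 1 → poissonIntegral ν z = poissonIntegral ν' z) : ν = ν' := by
  refine ext_of_forall_integral_eq_of_IsFiniteMeasure fun f =>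
    tendsto_nhds_unique (tendsto_integral_mul_poissonIntegral ν f.continuous)
      ((tendsto_integral_mul_poissonIntegral ν' f.continuous).congr' ?_)
  filter_upwards [eventually_abs_lt_one_nhdsLT] with r hr
  refine integral_congr_ae (Eventually.of_forall fun t => ?_)
  dsimp only
  rw [h _ (by rwa [norm_ofReal_mul_coe_sphere])]

/-! ### Herglotz's theorem and Clark measures -/

theorem poissonIntegral_zero (ν : Measure 𝕋) : poissonIntegral ν 0 = ν.real univ := by
  simp [poissonIntegral, poissonKernel_zero_coe]

/-- The measure on the unit circle whose density with respect to arc length is the real part of the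
dilation `t ↦ h (r t)` of a function `h` on the unit disk. -/
def dilatedMeasure (h : ℂ → ℂ) (r : ℝ) : Measure 𝕋 :=
  arcMeasure.withDensity fun t => ENNReal.ofReal (h (r * t)).re

section Herglotz

variable {h : ℂ → ℂ} (hd : DifferentiableOn ℂ h (Metric.ball 0 1)) {r : ℝ} (hr : |r| < 1)

include hd hr

theorem diffContOnCl_comp_ofReal_mul : DiffContOnCl ℂ (fun z => h (r * z)) (Metric.ball 0 1) := by
  refine DifferentiableOn.diffContOnCl ?_
  rw [closure_ball _ one_ne_zero]
  refine hd.comp (by fun_prop) fun z hz => ?_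
  rw [mem_closedBall_zero_iff] at hz
  rw [mem_ball_zero_iff, norm_mul, Complex.norm_real, Real.norm_eq_abs]
  exact (mul_le_of_le_one_right (abs_nonneg r) hz).trans_lt hr

theorem continuous_re_ofReal_mul_coe_sphere : Continuous fun t : 𝕋 => (h (r * t)).re := by
  refine Complex.continuous_re.comp (hd.continuousOn.comp_continuous (by fun_prop) fun t => ?_)
  rwa [mem_ball_zero_iff, norm_ofReal_mul_coe_sphere]

theorem isFiniteMeasure_dilatedMeasure : IsFiniteMeasure (dilatedMeasure h r) :=
  isFiniteMeasure_withDensity_ofReal (integrable_of_continuous_of_compactSpace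
    (continuous_re_ofReal_mul_coe_sphere hd hr) arcMeasure).2

variable (hre : ∀ z, ‖z‖ < 1 → 0 ≤ (h z).re)

include hre

theorem poissonIntegral_dilatedMeasure {z : ℂ} (hz : ‖z‖ < 1) :
    poissonIntegral (dilatedMeasure h r) z = (h (r * z)).re := by
  have hnonneg : ∀ t : 𝕋, 0 ≤ (h (r * t)).re := fun t =>
    hre _ (by rwa [norm_ofReal_mul_coe_sphere])
  rw [poissonIntegral, dilatedMeasure, integral_withDensity_eq_integral_toReal_smul
    (continuous_re_ofReal_mul_coe_sphere hd hr).measurable.ennreal_ofReal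
    (Eventually.of_forall fun _ => ENNReal.ofReal_lt_top)]
  simp only [ENNReal.toReal_ofReal (hnonneg _), smul_eq_mul, mul_comm (h _).re]
  exact integral_poissonKernel_mul_re (diffContOnCl_comp_ofReal_mul hd hr) hz

theorem dilatedMeasure_univ : dilatedMeasure h r univ = ENNReal.ofReal (h 0).re := by
  have := isFiniteMeasure_dilatedMeasure hd hr
  have hzero := poissonIntegral_dilatedMeasure hd hr hre (z := 0) (by simp)
  rw [poissonIntegral_zero, mul_zero] at hzero
  rw [← hzero, ofReal_measureReal]

end Herglotz

theorem exists_ultrafilter_tendsto_of_forall_mass_eq {X : Type*} [TopologicalSpace X]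
    [CompactSpace X] [T2Space X] [MeasurableSpace X] [BorelSpace X] {ι : Type*} (F : Filter ι)
    [F.NeBot] {Φ : ι → FiniteMeasure X} {c : NNReal} (hΦ : ∀ n, (Φ n).mass = c) :
    ∃ (U : Ultrafilter ι) (ν : FiniteMeasure X), ↑U ≤ F ∧ Tendsto Φ U (𝓝 ν) := by
  obtain ⟨ν, -, hν⟩ := isCompact_iff_ultrafilter_le_nhds.mp
    (isCompact_setOfPred_finiteMeasure_eq_of_compactSpace X c) ((Ultrafilter.of F).map Φ)
    (le_principal_iff.mpr (Filter.mem_map.mpr (Eventually.of_forall hΦ)))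
  exact ⟨Ultrafilter.of F, ν, Ultrafilter.of_le F, hν⟩

theorem exists_poissonIntegral_eq_re {h : ℂ → ℂ} (hd : DifferentiableOn ℂ h (Metric.ball 0 1))
    (hre : ∀ z, ‖z‖ < 1 → 0 ≤ (h z).re) :
    ∃ ν : Measure 𝕋, IsFiniteMeasure ν ∧ ∀ z : ℂ, ‖z‖ < 1 → poissonIntegral ν z = (h z).re := by
  obtain ⟨r, -, hr, hr1⟩ := exists_seq_strictMono_tendsto' (one_pos (α := ℝ))
  have hr' : ∀ n, |r n| < 1 := fun n => abs_lt.mpr ⟨by linarith [(hr n).1], (hr n).2⟩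
  let Φ : ℕ → FiniteMeasure 𝕋 := fun n =>
    ⟨dilatedMeasure h (r n), isFiniteMeasure_dilatedMeasure hd (hr' n)⟩
  have hmass : ∀ n, (Φ n).mass = (h 0).re.toNNReal := fun n =>
    congrArg ENNReal.toNNReal (dilatedMeasure_univ hd (hr' n) hre)
  obtain ⟨U, ν, hU, hν⟩ := exists_ultrafilter_tendsto_of_forall_mass_eq atTop hmass
  refine ⟨ν, inferInstance, fun z hz => ?_⟩
  have hweak : Tendsto (fun n => poissonIntegral (dilatedMeasure h (r n)) z) U
      (𝓝 (poissonIntegral ν z)) :=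
    FiniteMeasure.tendsto_iff_forall_integral_tendsto.mp hν
      (BoundedContinuousFunction.mkOfCompact ⟨_, continuous_poissonKernel_zero hz⟩)
  have hdil : Tendsto (fun n => (r n : ℂ) * z) atTop (𝓝 z) := by
    simpa using ((Complex.continuous_ofReal.tendsto 1).comp hr1).mul_const z
  have hcont : ContinuousAt h z :=
    hd.continuousOn.continuousAt (Metric.isOpen_ball.mem_nhds (by simpa using hz))
  simp only [poissonIntegral_dilatedMeasure hd (hr' _) hre hz] at hweak
  exact tendsto_nhds_unique hweak
    (((Complex.continuous_re.tendsto _).comp (hcont.tendsto.comp hdil)).mono_left hU)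

theorem one_sub_ne_zero_of_norm_lt_one {z : ℂ} (hz : ‖z‖ < 1) : 1 - z ≠ 0 := by
  rw [sub_ne_zero]
  rintro rfl
  simp at hz

theorem cayleyInv_im (z : ℂ) : (cayleyInv z).im = poissonKernel 0 z 1 := by
  rw [poissonKernel_eq_re_herglotzRieszKernel, Function.comp_apply, herglotzRieszKernel_def,
    cayleyInv, mul_div_assoc, Complex.I_mul_im, sub_zero, sub_zero]

theorem cayleyInv_im_pos {z : ℂ} (hz : ‖z‖ < 1) : 0 < (cayleyInv z).im := by
  have hne := one_sub_ne_zero_of_norm_lt_one hz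
  rw [cayleyInv_im, poissonKernel_def, sub_zero, sub_zero, norm_one, one_pow]
  exact div_pos (sub_pos.mpr (pow_lt_one₀ (norm_nonneg z) hz two_ne_zero)) (by positivity)

theorem differentiableOn_cayleyInv : DifferentiableOn ℂ cayleyInv (Metric.ball 0 1) := by
  unfold cayleyInv
  exact DifferentiableOn.div (by fun_prop) (by fun_prop) fun z hz =>
    one_sub_ne_zero_of_norm_lt_one (mem_ball_zero_iff.mp hz)

theorem re_add_div_sub_eq_poissonKernel (α b : ℂ) :
    ((α + b) / (α - b)).re = poissonKernel 0 b α := by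
  rw [poissonKernel_eq_re_herglotzRieszKernel, Function.comp_apply, herglotzRieszKernel_def,
    sub_zero, sub_zero]

theorem re_add_div_sub_nonneg {α b : ℂ} (h : ‖b‖ ≤ ‖α‖) : 0 ≤ ((α + b) / (α - b)).re := by
  rw [re_add_div_sub_eq_poissonKernel, poissonKernel_def, sub_zero, sub_zero]
  exact div_nonneg (sub_nonneg.mpr (pow_le_pow_left₀ (norm_nonneg b) h 2)) (by positivity)

theorem isCircleClarkMeasure_iff {b : ℂ → ℂ} {α : ℂ} {ν : Measure 𝕋} :
    IsCircleClarkMeasure b α ν ↔ IsFiniteMeasure ν ∧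
      ∀ z : ℂ, ‖z‖ < 1 → poissonIntegral ν z = ((α + b z) / (α - b z)).re := by
  simp only [IsCircleClarkMeasure, poissonIntegral, poissonKernel_zero_coe]

theorem existsUnique_isCircleClarkMeasure {b : ℂ → ℂ} {α : ℂ}
    (hd : DifferentiableOn ℂ b (Metric.ball 0 1)) (hb : ∀ z, ‖z‖ < 1 → ‖b z‖ ≤ ‖α‖)
    (hne : ∀ z, ‖z‖ < 1 → b z ≠ α) : ∃! ν, IsCircleClarkMeasure b α ν := by
  simp only [isCircleClarkMeasure_iff]
  obtain ⟨ν, hfin, hν⟩ := exists_poissonIntegral_eq_re (h := fun z => (α + b z) / (α - b z))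
    (DifferentiableOn.div (by fun_prop) (by fun_prop)
      fun z hz => sub_ne_zero.mpr (hne z (mem_ball_zero_iff.mp hz)).symm)
    (fun z hz => re_add_div_sub_nonneg (hb z hz))
  refine ⟨ν, ⟨hfin, hν⟩, ?_⟩
  rintro ν' ⟨hfin', hν'⟩
  exact eq_of_poissonIntegral_eq fun z hz => (hν' z hz).trans (hν z hz).symm

theorem existsUnique_isClarkMeasure {B : ℂ → ℂ} (hB : IsSchurUpper B) {α : ℂ} (hα : ‖α‖ = 1)
    (hne : ∀ w : ℂ, 0 < w.im → B w ≠ α) : ∃! μ, IsClarkMeasure B α μ := by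
  obtain ⟨ν, hν, huniq⟩ := existsUnique_isCircleClarkMeasure (b := fun z => B (cayleyInv z))
    (hB.1.comp differentiableOn_cayleyInv fun z hz => cayleyInv_im_pos (mem_ball_zero_iff.mp hz))
    (fun z hz => (hB.2 _ (cayleyInv_im_pos hz)).trans hα.ge)
    (fun z hz => hne _ (cayleyInv_im_pos hz))
  refine ⟨_, ⟨ν, hν, rfl⟩, ?_⟩
  rintro μ ⟨ν', hν', rfl⟩
  rw [huniq ν' hν']

/-! ### Boundary values of Poisson integrals -/

theorem continuous_mul_of_eventuallyEq_zero_nhdsSet {X : Type*} [TopologicalSpace X] {E : Set X}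
    (hE : IsClosed E) {f d : X → ℝ} (hf : Continuous f) (hfE : f =ᶠ[𝓝ˢ E] 0)
    (hd : ContinuousOn d Eᶜ) : Continuous fun x => f x * d x := by
  refine continuous_iff_continuousAt.mpr fun x => ?_
  by_cases hx : x ∈ E
  · refine (continuousAt_const (y := (0 : ℝ))).congr ?_
    filter_upwards [hfE.filter_mono (nhds_le_nhdsSet hx)] with y hy
    rw [hy, Pi.zero_apply, zero_mul]
  · exact hf.continuousAt.mul (hd.continuousAt (hE.isOpen_compl.mem_nhds hx))

theorem exists_continuous_eqOn_one_eventuallyEq_zero_nhdsSet {X : Type*} [TopologicalSpace X]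
    [NormalSpace X] {K E : Set X} (hK : IsClosed K) (hE : IsClosed E) (hKE : Disjoint K E) :
    ∃ χ : X → ℝ, Continuous χ ∧ (∀ x, 0 ≤ χ x) ∧ EqOn χ 1 K ∧ χ =ᶠ[𝓝ˢ E] 0 := by
  obtain ⟨V, hV, hEV, hVK⟩ := normal_exists_closure_subset hE hK.isOpen_compl
    (subset_compl_iff_disjoint_left.mpr hKE)
  obtain ⟨χ, hχV, hχK, hχ⟩ := exists_continuous_zero_one_of_isClosed isClosed_closure hK
    (subset_compl_iff_disjoint_right.mp hVK)
  exact ⟨χ, χ.continuous, fun x => (hχ x).1, hχK,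
    Filter.mem_of_superset (hV.mem_nhdsSet.mpr hEV) fun x hx => hχV (subset_closure hx)⟩

section WithDensity

variable {X : Type*} [MetricSpace X] [CompactSpace X] [MeasurableSpace X] [BorelSpace X]
  {ν ρ : Measure X} [IsFiniteMeasure ν] [IsFiniteMeasure ρ]

theorem withDensity_eq_withDensity_of_forall_integral {χ η : X → ℝ} (hχ : Continuous χ)
    (hη : Continuous η) (hχ0 : ∀ x, 0 ≤ χ x) (hη0 : ∀ x, 0 ≤ η x)
    (h : ∀ f : X → ℝ, Continuous f → ∫ x, χ x * f x ∂ν = ∫ x, η x * f x ∂ρ) :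
    (ν.withDensity fun x => ENNReal.ofReal (χ x)) =
      ρ.withDensity fun x => ENNReal.ofReal (η x) := by
  have := isFiniteMeasure_withDensity_ofReal (integrable_of_continuous_of_compactSpace hχ ν).2
  have := isFiniteMeasure_withDensity_ofReal (integrable_of_continuous_of_compactSpace hη ρ).2
  refine ext_of_forall_integral_eq_of_IsFiniteMeasure fun f => ?_
  rw [integral_withDensity_eq_integral_toReal_smul hχ.measurable.ennreal_ofReal
      (Eventually.of_forall fun _ => ENNReal.ofReal_lt_top),
    integral_withDensity_eq_integral_toReal_smul hη.measurable.ennreal_ofReal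
      (Eventually.of_forall fun _ => ENNReal.ofReal_lt_top)]
  simpa only [ENNReal.toReal_ofReal (hχ0 _), ENNReal.toReal_ofReal (hη0 _), smul_eq_mul] using
    h f f.continuous

variable {E : Set X} {d : X → ℝ} (hE : IsClosed E) (hd : ContinuousOn d Eᶜ) (hd0 : ∀ x, 0 ≤ d x)
  (h : ∀ f : X → ℝ, Continuous f → f =ᶠ[𝓝ˢ E] 0 → ∫ x, f x ∂ν = ∫ x, f x * d x ∂ρ)

include hE hd hd0 h

theorem restrict_eq_restrict_withDensity_of_disjoint {K : Set X} (hK : IsClosed K)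
    (hKE : Disjoint K E) :
    ν.restrict K = (ρ.withDensity fun x => ENNReal.ofReal (d x)).restrict K := by
  obtain ⟨χ, hχ, hχ0, hχK, hχE⟩ := exists_continuous_eqOn_one_eventuallyEq_zero_nhdsSet hK hE hKE
  have hcut : (ν.withDensity fun x => ENNReal.ofReal (χ x)) =
      ρ.withDensity fun x => ENNReal.ofReal (χ x * d x) := by
    refine withDensity_eq_withDensity_of_forall_integral hχ
      (continuous_mul_of_eventuallyEq_zero_nhdsSet hE hχ hχE hd) hχ0
      (fun x => mul_nonneg (hχ0 x) (hd0 x)) fun f hf => ?_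
    simpa only [Pi.mul_apply, mul_right_comm (χ _) (f _)] using
      h (χ * f) (hχ.mul hf) (hχE.mono fun x hx => by simp [hx])
  have hν : (ν.withDensity fun x => ENNReal.ofReal (χ x)).restrict K = ν.restrict K := by
    rw [restrict_withDensity hK.measurableSet]
    exact (withDensity_congr_ae (ae_restrict_of_forall_mem hK.measurableSet fun x hx => by
      simp [hχK hx])).trans withDensity_one
  rw [← hν, hcut, restrict_withDensity hK.measurableSet, restrict_withDensity hK.measurableSet]
  exact withDensity_congr_ae (ae_restrict_of_forall_mem hK.measurableSet fun x hx => by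
    simp [hχK hx])

theorem restrict_compl_eq_restrict_withDensity :
    ν.restrict Eᶜ = (ρ.withDensity fun x => ENNReal.ofReal (d x)).restrict Eᶜ := by
  obtain ⟨F, hF, hFE, hUnion, -⟩ := hE.isOpen_compl.exists_iUnion_isClosed
  rw [← hUnion, Measure.restrict_iUnion_congr]
  exact fun n => restrict_eq_restrict_withDensity_of_disjoint hE hd hd0 h (hF n)
    (disjoint_left.mpr fun x hx => hFE n hx)

end WithDensity

theorem ofReal_mul_coe_sphere_mem_closedBall_diff {E : Set 𝕋} {r : ℝ} (hr : r ∈ Icc (0 : ℝ) 1)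
    {t : 𝕋} (ht : t ∉ E) : (r * t : ℂ) ∈ Metric.closedBall (0 : ℂ) 1 \ (↑) '' E := by
  have hnorm : ‖(r * t : ℂ)‖ = r := by rw [norm_ofReal_mul_coe_sphere, abs_of_nonneg hr.1]
  refine ⟨mem_closedBall_zero_iff.mpr (hnorm.trans_le hr.2), ?_⟩
  rintro ⟨t', ht', heq⟩
  have hr1 : r = 1 := by rw [← hnorm, ← heq, mem_sphere_zero_iff_norm.mp t'.2]
  rw [hr1, Complex.ofReal_one, one_mul, Subtype.coe_inj] at heq
  exact ht (heq ▸ ht')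

theorem integral_eq_integral_mul_of_poissonIntegral_eq {ν : Measure 𝕋} [IsFiniteMeasure ν]
    {U : ℂ → ℝ} {E : Set 𝕋} (hE : IsClosed E)
    (hU : ContinuousOn U (Metric.closedBall 0 1 \ (↑) '' E))
    (hν : ∀ z : ℂ, ‖z‖ < 1 → poissonIntegral ν z = U z) {f : 𝕋 → ℝ} (hf : Continuous f)
    (hfE : f =ᶠ[𝓝ˢ E] 0) : ∫ t, f t ∂ν = ∫ t, f t * U t ∂arcMeasure := by
  let G : Icc (0 : ℝ) 1 → ℝ := fun r => ∫ t : 𝕋, f t * U ((r : ℝ) * t) ∂arcMeasure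
  have hG : Continuous G := by
    have hjoint : Continuous fun p : Icc (0 : ℝ) 1 × 𝕋 => f p.2 * U ((p.1 : ℝ) * p.2) :=
      continuous_mul_of_eventuallyEq_zero_nhdsSet (hE.preimage continuous_snd)
        (hf.comp continuous_snd)
        (hfE.comp_tendsto (continuous_snd.tendsto_nhdsSet (mapsTo_preimage _ _)))
        (hU.comp (by fun_prop) fun p hp => ofReal_mul_coe_sphere_mem_closedBall_diff p.1.2 hp)
    simpa only [Measure.restrict_univ] using
      continuous_parametric_integral_of_continuous (μ := arcMeasure)
        (f := fun (r : Icc (0 : ℝ) 1) (t : 𝕋) => f t * U ((r : ℝ) * t)) hjoint isCompact_univ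
  have hG1 : G (projIcc 0 1 zero_le_one 1) = ∫ t, f t * U t ∂arcMeasure := by
    simp only [G, projIcc_right, Complex.ofReal_one, one_mul]
  rw [← hG1]
  refine tendsto_nhds_unique (tendsto_integral_mul_poissonIntegral ν hf)
    ((((hG.comp continuous_projIcc).tendsto 1).mono_left nhdsWithin_le_nhds).congr' ?_)
  filter_upwards [Ioo_mem_nhdsLT one_pos] with r hr
  simp only [Function.comp_apply, G, projIcc_of_mem zero_le_one (Ioo_subset_Icc_self hr)]
  refine integral_congr_ae (Eventually.of_forall fun t => ?_)
  simp only
  rw [hν _ (by rw [norm_ofReal_mul_coe_sphere, abs_of_pos hr.1]; exact hr.2)]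

/-! ### The density of a Clark measure -/

theorem comap_withDensity_map {X Y : Type*} [MeasurableSpace X] [MeasurableSpace Y] {γ : X → Y}
    (hγ : MeasurableEmbedding γ) (ρ : Measure X) (u : Y → ENNReal) :
    ((ρ.map γ).withDensity u).comap γ = ρ.withDensity (u ∘ γ) := by
  ext s hs
  rw [hγ.comap_apply, withDensity_apply _ (hγ.measurableSet_image.mpr hs), hγ.restrict_map,
    hγ.lintegral_map, hγ.injective.preimage_image, withDensity_apply _ hs]
  rfl

theorem rnDeriv_ae_eq_of_restrict_compl {X : Type*} [MeasurableSpace X] {μ m : Measure X}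
    [SigmaFinite m] {N : Set X} (hN : MeasurableSet N) (hmN : m N = 0) {u : X → ENNReal}
    (hu : AEMeasurable u m) (h : μ.restrict Nᶜ = (m.withDensity u).restrict Nᶜ) :
    μ.rnDeriv m =ᵐ[m] u := by
  refine (Measure.eq_rnDeriv₀ (s := μ.restrict N) hu ⟨Nᶜ, hN.compl, ?_, ?_⟩ ?_).symm
  · rw [Measure.restrict_apply hN.compl, compl_inter_self, measure_empty]
  · rwa [compl_compl]
  · have hself : (m.withDensity u).restrict Nᶜ = m.withDensity u :=
      Measure.restrict_eq_self_of_ae_mem ((withDensity_absolutelyContinuous m u).ae_le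
        (measure_eq_zero_iff_ae_notMem.mp hmN))
    rw [← hself, ← h, Measure.restrict_add_restrict_compl hN]

theorem rnDeriv_comap_cayleyReal {ν : Measure 𝕋} [IsFiniteMeasure ν] {U : ℂ → ℝ} {E : Set 𝕋}
    (hE : E.Finite) (hU : ContinuousOn U (Metric.closedBall 0 1 \ (↑) '' E))
    (hU0 : ∀ t : 𝕋, 0 ≤ U t) (hν : ∀ z : ℂ, ‖z‖ < 1 → poissonIntegral ν z = U z) :
    (ν.comap cayleyReal).rnDeriv volume =ᵐ[volume] fun s =>
      ENNReal.ofReal (U (cayleyReal s)) * ProbabilityTheory.cauchyPDF 0 1 s := by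
  have hUE : ContinuousOn (fun t : 𝕋 => U t) Eᶜ :=
    hU.comp continuous_subtype_val.continuousOn fun t ht =>
      ⟨Metric.sphere_subset_closedBall t.2, fun ⟨t', ht', heq⟩ => ht (Subtype.ext heq ▸ ht')⟩
  have hrestrict := restrict_compl_eq_restrict_withDensity hE.isClosed hUE hU0
    fun f hf hfE => integral_eq_integral_mul_of_poissonIntegral_eq hE.isClosed hU hν hf hfE
  have hN : (cayleyReal ⁻¹' E).Finite := hE.preimage cayleyReal_injective.injOn
  have hmeas : AEMeasurable ((fun t : 𝕋 => ENNReal.ofReal (U t)) ∘ cayleyReal) volume := by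
    have hcont : ContinuousOn (fun s => U (cayleyReal s)) (cayleyReal ⁻¹' E)ᶜ :=
      hUE.comp continuous_cayleyReal.continuousOn fun s hs => hs
    have haem := hcont.aemeasurable (μ := volume) hN.measurableSet.compl
    rw [Measure.restrict_eq_self_of_ae_mem (s := (cayleyReal ⁻¹' E)ᶜ)
      (measure_eq_zero_iff_ae_notMem.mp (hN.measure_zero volume))] at haem
    exact haem.ennreal_ofReal
  have hPDF := (ProbabilityTheory.measurable_cauchyPDF 0 1).aemeasurable (μ := volume)
  refine rnDeriv_ae_eq_of_restrict_compl hN.measurableSet (hN.measure_zero volume)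
    (hmeas.mul hPDF) ?_
  have hcomap := congrArg (Measure.comap cayleyReal) hrestrict
  rw [measurableEmbedding_cayleyReal.comap_restrict, measurableEmbedding_cayleyReal.comap_restrict,
    arcMeasure, comap_withDensity_map measurableEmbedding_cayleyReal,
    ProbabilityTheory.cauchyMeasure_of_scale_ne_zero 0 one_ne_zero,
    ← withDensity_mul₀ hPDF hmeas, mul_comm, preimage_compl] at hcomap
  rw [hcomap]
  rfl

theorem cayleyInv_im_nonneg {z : ℂ} (hz : ‖z‖ ≤ 1) : 0 ≤ (cayleyInv z).im := by
  rw [cayleyInv_im, ← re_add_div_sub_eq_poissonKernel]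
  exact re_add_div_sub_nonneg (by rwa [norm_one])

theorem cayley_cayleyInv {z : ℂ} (hz : z ≠ 1) :
    (cayleyInv z - Complex.I) / (cayleyInv z + Complex.I) = z := by
  have hz' : 1 - z ≠ 0 := sub_ne_zero.mpr hz.symm
  have hadd : cayleyInv z + Complex.I = 2 * Complex.I / (1 - z) := by
    rw [cayleyInv]
    field_simp
    ring
  have hne : cayleyInv z + Complex.I ≠ 0 := by
    rw [hadd]
    exact div_ne_zero (mul_ne_zero two_ne_zero Complex.I_ne_zero) hz'
  rw [div_eq_iff hne, hadd, cayleyInv]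
  field_simp
  ring

theorem continuousAt_cayleyInv {z : ℂ} (hz : z ≠ 1) : ContinuousAt cayleyInv z := by
  unfold cayleyInv
  exact ContinuousAt.div (by fun_prop) (by fun_prop) (sub_ne_zero.mpr hz.symm)

theorem mapsTo_cayleyInv (S : Set ℝ) : MapsTo cayleyInv
    (Metric.closedBall 0 1 \ (↑) '' (insert 1 (cayleyReal '' S) : Set 𝕋))
    ({w | 0 ≤ w.im} \ (↑) '' S) := by
  rintro z ⟨hz, hzE⟩
  refine ⟨cayleyInv_im_nonneg (mem_closedBall_zero_iff.mp hz), ?_⟩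
  rintro ⟨s, hs, heq⟩
  have hz1 : z ≠ 1 := fun h => hzE ⟨1, mem_insert _ _, h.symm⟩
  refine hzE ⟨cayleyReal s, mem_insert_of_mem _ (mem_image_of_mem _ hs), ?_⟩
  rw [coe_cayleyReal, heq, cayley_cayleyInv hz1]

theorem IsClarkMeasure.rnDeriv_ae_eq {B B' : ℂ → ℂ} {α : ℂ} {μ : Measure ℝ} {S : Set ℝ}
    (hμ : IsClarkMeasure B α μ) (hS : S.Finite) (hBB' : EqOn B B' {w | 0 < w.im})
    (hcont : ContinuousOn B' ({w | 0 ≤ w.im} \ (↑) '' S))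
    (hnorm : ∀ w : ℂ, 0 ≤ w.im → ‖B' w‖ ≤ ‖α‖)
    (hne : ∀ w ∈ {w : ℂ | 0 ≤ w.im} \ (↑) '' S, B' w ≠ α) :
    μ.rnDeriv volume =ᵐ[volume] fun s : ℝ =>
      ENNReal.ofReal (((α + B' s) / (α - B' s)).re * ProbabilityTheory.cauchyPDFReal 0 1 s) := by
  obtain ⟨ν, hν, rfl⟩ := hμ
  obtain ⟨hfin, hν⟩ := isCircleClarkMeasure_iff.mp hν
  let U : ℂ → ℝ := fun z => ((α + B' (cayleyInv z)) / (α - B' (cayleyInv z))).re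
  have hU0 : ∀ z, ‖z‖ ≤ 1 → 0 ≤ U z := fun z hz =>
    re_add_div_sub_nonneg (hnorm _ (cayleyInv_im_nonneg hz))
  have hU : ContinuousOn U
      (Metric.closedBall 0 1 \ (↑) '' (insert 1 (cayleyReal '' S) : Set 𝕋)) := by
    have hcomp := hcont.comp (fun z hz => (continuousAt_cayleyInv fun h =>
      hz.2 ⟨1, mem_insert _ _, h.symm⟩).continuousWithinAt) (mapsTo_cayleyInv S)
    exact Complex.continuous_re.comp_continuousOn ((continuousOn_const.add hcomp).div
      (continuousOn_const.sub hcomp) fun z hz =>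
        sub_ne_zero.mpr (hne _ (mapsTo_cayleyInv S hz)).symm)
  have hrn := rnDeriv_comap_cayleyReal ((hS.image cayleyReal).insert 1) hU
    (fun t => hU0 t (mem_sphere_zero_iff_norm.mp t.2).le)
    (fun z hz => by rw [hν z hz, hBB' (cayleyInv_im_pos hz)])
  filter_upwards [hrn] with s hs
  rw [hs, ProbabilityTheory.cauchyPDF,
    ← ENNReal.ofReal_mul (hU0 _ (mem_sphere_zero_iff_norm.mp (cayleyReal s).2).le)]
  simp only [U, cayleyInv_cayleyReal]

/-! ### The Livšic function of the half-line -/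

namespace HalfLine

theorem continuousWithinAt_csqrt {w : ℂ} (h0 : w ≠ 0) :
    ContinuousWithinAt csqrt {w | 0 ≤ w.im} w := by
  have hlog : ContinuousWithinAt Complex.log {w | 0 ≤ w.im} w := by
    by_cases hs : w ∈ Complex.slitPlane
    · exact (continuousAt_clog hs).continuousWithinAt
    · rw [Complex.mem_slitPlane_iff, not_or, not_lt, not_not] at hs
      exact Complex.continuousWithinAt_log_of_re_neg_of_im_zero
        (hs.1.lt_of_ne fun h => h0 (Complex.ext h hs.2)) hs.2
  have hexp : ContinuousWithinAt (fun w => Complex.exp (Complex.log w * (1 / 2)))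
      {w | 0 ≤ w.im} w := (hlog.mul continuousWithinAt_const).cexp
  refine hexp.congr_of_eventuallyEq ?_ (by rw [csqrt, Complex.cpow_def_of_ne_zero h0])
  filter_upwards [mem_nhdsWithin_of_mem_nhds (isOpen_ne.mem_nhds h0)] with v hv
  rw [csqrt, Complex.cpow_def_of_ne_zero hv]

theorem differentiableAt_csqrt {w : ℂ} (hw : 0 < w.im) : DifferentiableAt ℂ csqrt w :=
  differentiableAt_id.cpow (differentiableAt_const _) (Or.inr hw.ne')

theorem csqrt_injective : Function.Injective csqrt :=
  Function.LeftInverse.injective (g := fun z => z ^ 2) csqrt_sq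

theorem csqrt_ofReal_re_of_nonpos {s : ℝ} (hs : s ≤ 0) : (csqrt (s : ℂ)).re = 0 := by
  rw [csqrt, one_div, Complex.cpow_inv_two_re, Complex.norm_real, Complex.ofReal_re,
    Real.norm_of_nonpos hs, neg_add_cancel, zero_div, Real.sqrt_zero]

theorem csqrt_ofReal_of_pos {s : ℝ} (hs : 0 < s) : csqrt (s : ℂ) = (Real.sqrt s : ℝ) := by
  refine csqrt_eq_of_sq_eq ?_ (Real.sqrt_pos.mpr hs)
  rw [← Complex.ofReal_pow, Real.sq_sqrt hs.le]

theorem livsic_formula {w : ℂ} (hw : 0 < w.im) :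
    livsic psi phiPlus phiMinus w =
      ((w - Complex.I) * (csqrt w - starRingEnd ℂ eighthRoot)) /
        ((w + Complex.I) * (csqrt w + eighthRoot)) := by
  have hplus : Complex.I * csqrt w + -eighthRoot =
      Complex.I * (csqrt w - starRingEnd ℂ eighthRoot) := by
    linear_combination I_mul_conj_eighthRoot
  have hminus : Complex.I * csqrt w + -starRingEnd ℂ eighthRoot =
      Complex.I * (csqrt w + eighthRoot) := by
    linear_combination -I_mul_eighthRoot
  have hψ := I_mul_csqrt_re_neg hw
  have hI := Complex.I_ne_zero
  have hq := two_rpow_fourth_ne_zero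
  rw [livsic, phiPlus_eq, phiMinus_eq, psi, inner_smul_left, inner_smul_left, Complex.conj_ofReal,
    inner_expVec_expVec neg_conj_eighthRoot_re_neg hψ,
    inner_expVec_expVec neg_eighthRoot_re_neg hψ, map_neg, map_neg, Complex.conj_conj,
    add_comm (-eighthRoot), add_comm (-starRingEnd ℂ eighthRoot), hplus, hminus, mul_inv, inv_neg,
    inv_inv, mul_inv]
  field_simp

/-- The continuous extension of the Livšic function to the closed upper half-plane. -/
def livsicExt (w : ℂ) : ℂ := (csqrt w - eighthRoot) / (csqrt w + starRingEnd ℂ eighthRoot)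

theorem csqrt_add_ne_zero (w : ℂ) {c : ℂ} (hc : 0 < c.re) : csqrt w + c ≠ 0 := fun h => by
  have hre := congrArg Complex.re h
  rw [Complex.add_re, Complex.zero_re] at hre
  linarith [csqrt_re_nonneg w]

theorem csqrt_add_conj_eighthRoot_ne_zero (w : ℂ) : csqrt w + starRingEnd ℂ eighthRoot ≠ 0 :=
  csqrt_add_ne_zero w eighthRoot_re_pos

theorem livsic_eq_livsicExt {w : ℂ} (hw : 0 < w.im) :
    livsic psi phiPlus phiMinus w = livsicExt w := by
  have hsub : w - Complex.I = (csqrt w - eighthRoot) * (csqrt w + eighthRoot) := by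
    linear_combination -csqrt_sq w + eighthRoot_sq
  have hadd : w + Complex.I =
      (csqrt w - starRingEnd ℂ eighthRoot) * (csqrt w + starRingEnd ℂ eighthRoot) := by
    linear_combination -csqrt_sq w + conj_eighthRoot_sq
  have hplus := csqrt_add_ne_zero w eighthRoot_re_pos
  have hconj := csqrt_add_conj_eighthRoot_ne_zero w
  have hminus : csqrt w - starRingEnd ℂ eighthRoot ≠ 0 := by
    intro h
    rw [h, zero_mul] at hadd
    have him := congrArg Complex.im hadd
    rw [Complex.add_im, Complex.I_im, Complex.zero_im] at him
    linarith
  rw [livsic_formula hw, livsicExt, hsub, hadd]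
  field_simp

theorem norm_add_conj_eighthRoot_sq_sub_norm_sub_eighthRoot_sq (z : ℂ) :
    ‖z + starRingEnd ℂ eighthRoot‖ ^ 2 - ‖z - eighthRoot‖ ^ 2 = 2 * Real.sqrt 2 * z.re := by
  have hsqrt : 2 * (Real.sqrt 2)⁻¹ = Real.sqrt 2 := Real.div_sqrt
  rw [Complex.sq_norm, Complex.sq_norm, Complex.normSq_apply, Complex.normSq_apply]
  simp only [Complex.add_re, Complex.sub_re, Complex.add_im, Complex.sub_im, Complex.conj_re,
    Complex.conj_im, eighthRoot_re, eighthRoot_im]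
  linear_combination 2 * z.re * hsqrt

theorem norm_livsicExt_le_one (w : ℂ) : ‖livsicExt w‖ ≤ 1 := by
  have h := norm_add_conj_eighthRoot_sq_sub_norm_sub_eighthRoot_sq (csqrt w)
  have hre := csqrt_re_nonneg w
  rw [livsicExt, norm_div, div_le_one (norm_pos_iff.mpr (csqrt_add_conj_eighthRoot_ne_zero w))]
  exact (sq_le_sq₀ (norm_nonneg _) (norm_nonneg _)).mp (sub_nonneg.mp (h ▸ by positivity))

theorem norm_livsicExt_lt_one {w : ℂ} (hw : 0 < w.im) : ‖livsicExt w‖ < 1 := by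
  have h := norm_add_conj_eighthRoot_sq_sub_norm_sub_eighthRoot_sq (csqrt w)
  have hre := csqrt_re_pos hw
  rw [livsicExt, norm_div, div_lt_one (norm_pos_iff.mpr (csqrt_add_conj_eighthRoot_ne_zero w))]
  exact lt_of_pow_lt_pow_left₀ 2 (norm_nonneg _) (sub_pos.mp (h ▸ by positivity))

theorem isSchurUpper_livsic : IsSchurUpper (livsic psi phiPlus phiMinus) := by
  refine ⟨?_, fun w hw => (livsic_eq_livsicExt hw).symm ▸ norm_livsicExt_le_one w⟩
  refine DifferentiableOn.congr (f := livsicExt) (fun w hw => ?_) fun w hw => livsic_eq_livsicExt hw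
  exact (((differentiableAt_csqrt hw).sub_const _).div ((differentiableAt_csqrt hw).add_const _)
    (csqrt_add_conj_eighthRoot_ne_zero w)).differentiableWithinAt

theorem livsicExt_injective : Function.Injective livsicExt := by
  intro w w' h
  rw [livsicExt, livsicExt, div_eq_div_iff (csqrt_add_conj_eighthRoot_ne_zero w)
    (csqrt_add_conj_eighthRoot_ne_zero w')] at h
  have hne : eighthRoot + starRingEnd ℂ eighthRoot ≠ 0 := by
    rw [Complex.add_conj, Complex.ofReal_ne_zero]
    linarith [eighthRoot_re_pos]
  have hmul : (csqrt w - csqrt w') * (eighthRoot + starRingEnd ℂ eighthRoot) = 0 := by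
    linear_combination h
  exact csqrt_injective (sub_eq_zero.mp ((mul_eq_zero.mp hmul).resolve_right hne))

theorem continuousOn_livsicExt : ContinuousOn livsicExt ({w | 0 ≤ w.im} \ {0}) := fun w hw =>
  have hcsqrt := (continuousWithinAt_csqrt hw.2).mono sdiff_subset
  (hcsqrt.sub continuousWithinAt_const).div (hcsqrt.add continuousWithinAt_const)
    (csqrt_add_conj_eighthRoot_ne_zero w)

theorem existsUnique_isClarkMeasure_livsic {α : ℂ} (hα : ‖α‖ = 1) :
    ∃! μ, IsClarkMeasure (livsic psi phiPlus phiMinus) α μ := by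
  refine existsUnique_isClarkMeasure isSchurUpper_livsic hα fun w hw h => ?_
  rw [livsic_eq_livsicExt hw] at h
  exact (norm_livsicExt_lt_one hw).ne (h ▸ hα)

theorem rnDeriv_ae_eq_re_livsicExt {α : ℂ} (hα : ‖α‖ = 1) {μ : Measure ℝ}
    (hμ : IsClarkMeasure (livsic psi phiPlus phiMinus) α μ) :
    μ.rnDeriv volume =ᵐ[volume] fun s : ℝ => ENNReal.ofReal
      (((α + livsicExt s) / (α - livsicExt s)).re * ProbabilityTheory.cauchyPDFReal 0 1 s) := by
  have hS : {s : ℝ | livsicExt s = α}.Subsingleton := fun s hs t ht =>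
    Complex.ofReal_injective (livsicExt_injective (hs.trans ht.symm))
  refine hμ.rnDeriv_ae_eq (hS.finite.insert 0) (fun w hw => livsic_eq_livsicExt hw)
    (continuousOn_livsicExt.mono ?_) (fun w _ => (norm_livsicExt_le_one w).trans hα.ge) ?_
  · rintro w ⟨hw, hwS⟩
    exact ⟨hw, fun h => hwS ⟨0, mem_insert _ _, h.symm⟩⟩
  · rintro w ⟨hw, hwS⟩ h
    rcases (show 0 ≤ w.im from hw).lt_or_eq with hpos | hzero
    · exact (norm_livsicExt_lt_one hpos).ne (h ▸ hα)
    · have hre : (w.re : ℂ) = w := Complex.ext rfl hzero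
      exact hwS ⟨w.re, mem_insert_of_mem _ (hre.symm ▸ h), hre⟩

/-! ### The explicit density -/

theorem re_add_livsicExt_div_sub {α : ℂ} (hα : ‖α‖ = 1) (w : ℂ) :
    ((α + livsicExt w) / (α - livsicExt w)).re = 2 * Real.sqrt 2 * (csqrt w).re /
      ‖α * (csqrt w + starRingEnd ℂ eighthRoot) - (csqrt w - eighthRoot)‖ ^ 2 := by
  have h := csqrt_add_conj_eighthRoot_ne_zero w
  rw [livsicExt, add_div' _ _ _ h, sub_div' h, div_div_div_cancel_right₀ h,
    re_add_div_sub_eq_poissonKernel, poissonKernel_def, sub_zero, sub_zero, norm_mul, hα, one_mul,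
    norm_add_conj_eighthRoot_sq_sub_norm_sub_eighthRoot_sq]

theorem exp_neg_I_mul_pi_div_four :
    Complex.exp (-(Complex.I * Real.pi / 4)) = starRingEnd ℂ eighthRoot := by
  have harg : -(Complex.I * Real.pi / 4) = ((-(Real.pi / 4) : ℝ) : ℂ) * Complex.I := by
    push_cast
    ring
  have hsqrt : Real.sqrt 2 / 2 = (Real.sqrt 2)⁻¹ := Real.sqrt_div_self
  apply Complex.ext
  · rw [harg, Complex.exp_ofReal_mul_I_re, Real.cos_neg, Real.cos_pi_div_four, Complex.conj_re,
      eighthRoot_re, hsqrt]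
  · rw [harg, Complex.exp_ofReal_mul_I_im, Real.sin_neg, Real.sin_pi_div_four, Complex.conj_im,
      eighthRoot_im, hsqrt]

section UnitCircle

variable {α : ℂ} (hα : ‖α‖ = 1)

include hα

theorem re_sq_add_im_sq_of_norm_eq_one : α.re ^ 2 + α.im ^ 2 = 1 := by
  have h := Complex.sq_norm α
  rw [hα, Complex.normSq_apply] at h
  linarith

theorem norm_mul_add_sub_sub_eighthRoot_sq (x : ℝ) :
    ‖α * ((x : ℂ) + starRingEnd ℂ eighthRoot) - ((x : ℂ) - eighthRoot)‖ ^ 2 =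
      2 * (1 - α.re) * x ^ 2 + 2 * (1 + α.im) := by
  have hnorm := re_sq_add_im_sq_of_norm_eq_one hα
  have hsqrt : (Real.sqrt 2)⁻¹ ^ 2 = 1 / 2 := by
    rw [inv_pow, Real.sq_sqrt zero_le_two, one_div]
  rw [Complex.sq_norm, Complex.normSq_apply]
  simp only [Complex.add_re, Complex.sub_re, Complex.add_im, Complex.sub_im, Complex.conj_re,
    Complex.conj_im, eighthRoot_re, eighthRoot_im, Complex.mul_re, Complex.mul_im,
    Complex.ofReal_re, Complex.ofReal_im]
  generalize (Real.sqrt 2)⁻¹ = c at *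
  linear_combination (x ^ 2 + 2 * c * x + 2 * c ^ 2) * hnorm + (4 + 4 * α.im) * hsqrt

theorem norm_I_mul_sub_one_sq : ‖Complex.I * α - 1‖ ^ 2 = 2 + 2 * α.im := by
  rw [Complex.sq_norm, Complex.normSq_apply]
  simp only [Complex.sub_re, Complex.sub_im, Complex.I_mul_re, Complex.I_mul_im, Complex.one_re,
    Complex.one_im]
  linear_combination re_sq_add_im_sq_of_norm_eq_one hα

theorem denomD_of_pos {s : ℝ} (hs : 0 < s) :
    denomD α s = (((s + 1 - Real.sqrt 2 * Real.sqrt s) *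
      (2 * (1 - α.re) * s + 2 * (1 + α.im)) : ℝ) : ℂ) := by
  have htwo : (2 : ℝ) ^ (3 / 2 : ℝ) = 2 * Real.sqrt 2 := by
    rw [show (3 / 2 : ℝ) = 1 + 1 / 2 by norm_num, Real.rpow_add zero_lt_two, Real.rpow_one,
      Real.sqrt_eq_rpow]
  have hhalf : (s : ℂ) ^ (1 / 2 : ℂ) = (Real.sqrt s : ℝ) := csqrt_ofReal_of_pos hs
  have hthree : (s : ℂ) ^ (3 / 2 : ℂ) = ((s * Real.sqrt s : ℝ) : ℂ) := by
    rw [show (3 / 2 : ℂ) = 1 + 1 / 2 by norm_num,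
      Complex.cpow_add _ _ (Complex.ofReal_ne_zero.mpr hs.ne'), Complex.cpow_one, hhalf,
      Complex.ofReal_mul]
  rw [denomD, norm_I_mul_sub_one_sq hα, htwo, hhalf, hthree, abs_of_pos hs]
  push_cast
  ring

theorem re_add_livsicExt_div_sub_of_pos {s : ℝ} (hs : 0 < s) :
    ((α + livsicExt s) / (α - livsicExt s)).re =
      2 * Real.sqrt 2 * Real.sqrt s / (2 * (1 - α.re) * s + 2 * (1 + α.im)) := by
  rw [re_add_livsicExt_div_sub hα, csqrt_ofReal_of_pos hs, norm_mul_add_sub_sub_eighthRoot_sq hα,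
    Real.sq_sqrt hs.le, Complex.ofReal_re]

theorem weight_of_pos {s : ℝ} (hs : 0 < s) :
    weight α s = (2 * Real.sqrt 2 * Real.sqrt s / (2 * (1 - α.re) * s + 2 * (1 + α.im)) *
      ProbabilityTheory.cauchyPDFReal 0 1 s : ℝ) := by
  have hnum : csqrt (2 * (s : ℂ)) = (Real.sqrt 2 * Real.sqrt s : ℝ) := by
    rw [← Real.sqrt_mul zero_le_two, ← csqrt_ofReal_of_pos (by positivity)]
    push_cast
    rfl
  have hre : 2 * ((Real.sqrt s : ℂ) * starRingEnd ℂ eighthRoot).re = Real.sqrt 2 * Real.sqrt s := by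
    have hsqrt : 2 * (Real.sqrt 2)⁻¹ = Real.sqrt 2 := Real.div_sqrt
    rw [Complex.re_ofReal_mul, Complex.conj_re, eighthRoot_re]
    linear_combination Real.sqrt s * hsqrt
  have hfactor : (s + 1 + Real.sqrt 2 * Real.sqrt s) * (s + 1 - Real.sqrt 2 * Real.sqrt s) =
      s ^ 2 + 1 := by
    rw [← sq_sub_sq, mul_pow, Real.sq_sqrt zero_le_two, Real.sq_sqrt hs.le]
    ring
  rw [weight, csqrt_ofReal_of_pos hs, hnum, exp_neg_I_mul_pi_div_four, hre, denomD_of_pos hα hs,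
    abs_of_pos hs, Complex.ofReal_re, ProbabilityTheory.cauchyPDFReal, ← Complex.ofReal_mul,
    ← Complex.ofReal_div, ← mul_assoc (_ * _), mul_assoc Real.pi, hfactor]
  congr 1
  simp only [NNReal.coe_one, sub_zero, one_pow, mul_one, div_eq_mul_inv, mul_inv]
  ring

end UnitCircle

theorem weight_of_nonpos (α : ℂ) {s : ℝ} (hs : s ≤ 0) : weight α s = 0 := by
  have h := csqrt_ofReal_re_of_nonpos (mul_nonpos_of_nonneg_of_nonpos zero_le_two hs)
  rw [Complex.ofReal_mul, Complex.ofReal_ofNat] at h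
  rw [weight, h, mul_zero, Complex.ofReal_zero, zero_div]

theorem weight_eq {α : ℂ} (hα : ‖α‖ = 1) (s : ℝ) :
    weight α s = (((α + livsicExt s) / (α - livsicExt s)).re *
      ProbabilityTheory.cauchyPDFReal 0 1 s : ℝ) := by
  rcases le_or_gt s 0 with hs | hs
  · rw [weight_of_nonpos α hs, re_add_livsicExt_div_sub hα, csqrt_ofReal_re_of_nonpos hs, mul_zero,
      zero_div, zero_mul, Complex.ofReal_zero]
  · rw [weight_of_pos hα hs, re_add_livsicExt_div_sub_of_pos hα hs]

open scoped ComplexOrder in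
theorem weight_nonneg {α : ℂ} (hα : ‖α‖ = 1) (s : ℝ) : 0 ≤ weight α s := by
  rw [weight_eq hα, Complex.zero_le_real]
  exact mul_nonneg (re_add_div_sub_nonneg ((norm_livsicExt_le_one s).trans hα.ge))
    (ProbabilityTheory.cauchyPDF_pos 0 one_ne_zero s).le

theorem rnDeriv_ae_eq_weight {α : ℂ} (hα : ‖α‖ = 1) {μ : Measure ℝ}
    (hμ : IsClarkMeasure (livsic psi phiPlus phiMinus) α μ) :
    ∀ᵐ s, μ.rnDeriv volume s = ENNReal.ofReal (weight α s).re := by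
  filter_upwards [rnDeriv_ae_eq_re_livsicExt hα hμ] with s hs
  rw [hs, weight_eq hα, Complex.ofReal_re]

end HalfLine

end

theorem mainTheorem7 :
    IsDefectBasis HalfLine.kMin HalfLine.psi HalfLine.phiPlus HalfLine.phiMinus ∧
    (∀ w : ℂ, 0 < w.im →
      livsic HalfLine.psi HalfLine.phiPlus HalfLine.phiMinus w =
        ((w - Complex.I) * (HalfLine.csqrt w - (1 - Complex.I) / (Real.sqrt 2 : ℂ))) /
          ((w + Complex.I) * (HalfLine.csqrt w + (1 + Complex.I) / (Real.sqrt 2 : ℂ)))) ∧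
    IsSchurUpper (livsic HalfLine.psi HalfLine.phiPlus HalfLine.phiMinus) ∧
    ∀ α : ℂ, ‖α‖ = 1 →
      HalfLine.kMin ≤ HalfLine.kExt α ∧ IsSelfAdjoint (HalfLine.kExt α) ∧
      (∃! μ : Measure ℝ,
        IsClarkMeasure (livsic HalfLine.psi HalfLine.phiPlus HalfLine.phiMinus) α μ) ∧
      ∀ μ : Measure ℝ,
        IsClarkMeasure (livsic HalfLine.psi HalfLine.phiPlus HalfLine.phiMinus) α μ →
        (∀ᵐ s : ℝ, ((μ.rnDeriv volume s).toReal : ℂ) = HalfLine.weight α s) ∧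
        (∀ᵐ s : ℝ, s ≤ 0 → μ.rnDeriv volume s = 0) := by
  refine ⟨HalfLine.isDefectBasis_kMin, fun w hw => ?_, HalfLine.isSchurUpper_livsic,
    fun α hα => ⟨HalfLine.kMin_le_kExt α, HalfLine.isSelfAdjoint_kExt hα,
      HalfLine.existsUnique_isClarkMeasure_livsic hα, fun μ hμ => ⟨?_, ?_⟩⟩⟩
  · rw [HalfLine.livsic_formula hw, HalfLine.conj_eighthRoot, HalfLine.eighthRoot]
  · filter_upwards [HalfLine.rnDeriv_ae_eq_weight hα hμ] with s hs
    obtain ⟨hre, him⟩ := Complex.nonneg_iff.mp (HalfLine.weight_nonneg hα s)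
    rw [hs, ENNReal.toReal_ofReal hre]
    exact Complex.ext rfl him
  · filter_upwards [HalfLine.rnDeriv_ae_eq_weight hα hμ] with s hs hs0
    rw [hs, HalfLine.weight_of_nonpos α hs0, Complex.zero_re, ENNReal.ofReal_zero]
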